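/- **Conventions.** Let $X$ be a connected CW-complex with finite $k$-skeleton, for some integer $k\ge 1$, with base point $x_0$, fundamental group $G=\pi_1(X,x_0)$ and universal cover $\widetilde X$, on which $G$ acts on the left by deck transformations. For a right $\mathbb{Z}G$-module $A$, let $H_i(X,A)$ be the homology of the complex $A\otimes_{\mathbb{Z}G}C_\bullet(\widetilde X,\mathbb{Z})$. * For a field $\Bbbk$ and a homomorphism $\rho\colon G\to\Bbbk^\times$, let $\Bbbk_\rho$ be $\Bbbk$ with $g\in G$ acting as multiplication by $\rho(g)$, and set $\mathcal V^i_1(X,\Bbbk)=\{\rho\in\mathrm{Hom}(G,\Bbbk^\times)\mid \dim_\Bbbk H_i(X,\Bbbk_\rho)\ge 1\}$ for $0\le i\le k$. * For an additive character $\chi\colon G\to\mathbb{R}$, let $\widehat{\mathbb{Z}G}_{\chi}$ be the Novikov–Sikorav completion: the ring of all formal sums $\sum_{g\in G} n_g g$ with $n_g\in\mathbb{Z}$ such that, for each $c\in\mathbb{R}$, the set $\{g\mid n_g\neq 0,\ \chi(g)\ge c\}$ is finite. It contains $\mathbb{Z}G$ as a subring and is a right $\mathbb{Z}G$-module by multiplication.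 For $q\ge 0$, set $$\Sigma^q(X,\mathbb{Z})=\{\chi\in\mathrm{Hom}(G,\mathbb{R})\setminus\{0\}\mid H_i(X,\widehat{\mathbb{Z}G}_{-\chi})=0\text{ for all } i\le q\}.$$ * A valuation on $\Bbbk$ is a homomorphism $v\colon\Bbbk^\times\to\mathbb{R}$ to the additive group of $\mathbb{R}$ such that, with $v(0)=+\infty$, $v(a+b)\ge\min(v(a),v(b))$ for all $a,b\in\Bbbk$. * Factor an additive character $\chi\colon G\to\mathbb{R}$ as $\chi=\iota\circ\xi$, where $\Gamma=\operatorname{im}(\chi)$, $\xi\colon G\twoheadrightarrow\Gamma$ is the corestriction of $\chi$ and $\iota\colon\Gamma\hookrightarrow\mathbb{R}$ is the inclusion. A homomorphism $\rho\colon\Gamma\to\Bbbk^\times$ is called an algebraic integer if there is $\Delta=\sum_\gamma n_\gamma\gamma\in\mathbb{Z}\Gamma$ with $\Delta(\rho):=\sum_\gamma n_\gamma\rho(\gamma)=0$ in $\Bbbk$ and $n_{\gamma_0}=1$, where $\gamma_0$ is the greatest element of $\{\gamma\in\Gamma\mid n_\gamma\ne 0\}\subset\mathbb{R}$. **Theorem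 1.2.** Let $X$, $k$ and $G$ be as above, let $\Bbbk$ be any field, and let $0\le q\le k$. 1. Let $\rho\colon G\to\Bbbk^\times$ be a homomorphism such that $\rho\in\bigcup_{i\le q}\mathcal V^i_1(X,\Bbbk)$, and let $v\colon\Bbbk^\times\to\mathbb{R}$ be a valuation on $\Bbbk$ such that $v\circ\rho\neq 0$. Then $v\circ\rho\notin\Sigma^q(X,\mathbb{Z})$. 2. Let $\chi=\iota\circ\xi\colon G\to\mathbb{R}$ be an additive character such that $-\chi\in\Sigma^q(X,\mathbb{Z})$, and let $\rho\colon\Gamma\to\Bbbk^\times$ be a homomorphism that is not an algebraic integer. Then $\rho\circ\xi\notin\bigcup_{i\le q}\mathcal V^i_1(X,\Bbbk)$. -/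

import Mathlib

open Topology TensorProduct

noncomputable section

namespace BNSR

/-! ## The fundamental group and the universal cover

Throughout, `X` is a space with base point `x₀`. A point of the universal cover `X̃` over `x : X`
is a homotopy class, relative to the endpoints, of paths in `X` from `x₀` to `x`. -/

/-- The fundamental group `π₁(X, x₀)`, where the product of two classes of loops is their
concatenation: first the left factor, then the right one. (The product of Mathlib's
`FundamentalGroup` is in the opposite order, see `FundamentalGroup.mul_def`.) -/
abbrev Pi1 (X : Type*) [TopologicalSpace X] (x₀ : X) : Type _ := (FundamentalGroup X x₀)ᵐᵒᵖ

/-- The homotopy class of loops underlying an element of the fundamental group. -/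
def Pi1.loop {X : Type*} [TopologicalSpace X] {x₀ : X} (g : Pi1 X x₀) :
    Path.Homotopic.Quotient x₀ x₀ :=
  FundamentalGroup.toPath g.unop

/-- A map from a space `T` to the universal cover `X̃` of `(X, x₀)`: a continuous map `T → X`,
together with, for each `t`, a point of `X̃` over the image of `t`, such that every path in `T` is
sent to the lift of its image in `X`. (Lifting a path `γ` in `X` that starts at `x` to the point
`τ` of `X̃` over `x` ends at the concatenation of `τ` and `γ`.) When `X` is a CW complex and `T`
is a simplex, these are exactly the continuous maps from `T` to the covering space `X̃`. -/
@[ext]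
structure LiftedMap (T : Type*) [TopologicalSpace T] (X : Type*) [TopologicalSpace X] (x₀ : X) where
  /-- the map to `X`, that is, the composite with the covering projection -/
  proj : C(T, X)
  /-- the points of `X̃` over the values of `proj` -/
  lift : ∀ t : T, Path.Homotopic.Quotient x₀ (proj t)
  /-- paths in `T` go to lifts of paths -/
  lift_path : ∀ {s t : T} (η : Path s t),
    (lift s).trans (Path.Homotopic.Quotient.mk (η.map proj.continuous)) = lift t

namespace LiftedMap

variable {T T' X : Type*} [TopologicalSpace T] [TopologicalSpace T'] [TopologicalSpace X] {x₀ : X}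

/-- Precomposition of a map to `X̃` with a continuous map. -/
def comp (σ : LiftedMap T X x₀) (f : C(T', T)) : LiftedMap T' X x₀ where
  proj := σ.proj.comp f
  lift t := σ.lift (f t)
  lift_path η := σ.lift_path (η.map f.continuous)

/-- The left action of the fundamental group on `X̃` by deck transformations: the class of a loop
`γ` sends the class of a path `α` that starts at `x₀` to the class of the concatenation of `γ`
and `α`. Here it acts on the maps from `T` to `X̃`. -/
instance : MulAction (Pi1 X x₀) (LiftedMap T X x₀) where
  smul g σ :=
    { proj := σ.proj
      lift := fun t => g.loop.trans (σ.lift t)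
      lift_path := fun η => by
        rw [Path.Homotopic.Quotient.trans_assoc, σ.lift_path] }
  one_smul σ := LiftedMap.ext rfl <| heq_of_eq <| funext fun t =>
    Path.Homotopic.Quotient.refl_trans (σ.lift t)
  mul_smul g h σ := LiftedMap.ext rfl <| heq_of_eq <| funext fun t =>
    Path.Homotopic.Quotient.trans_assoc g.loop h.loop (σ.lift t)

@[simp] theorem smul_proj (g : Pi1 X x₀) (σ : LiftedMap T X x₀) : (g • σ).proj = σ.proj := rfl

theorem smul_lift (g : Pi1 X x₀) (σ : LiftedMap T X x₀) (t : T) :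
    (g • σ).lift t = g.loop.trans (σ.lift t) := rfl

theorem smul_comp (g : Pi1 X x₀) (σ : LiftedMap T X x₀) (f : C(T', T)) :
    (g • σ).comp f = g • σ.comp f := rfl

/-- Unique lifting: a continuous map from a simply connected space `T` (such as a simplex) to `X`
has exactly one lift to `X̃` with a prescribed value at a given point. -/
theorem existsUnique_lift [SimplyConnectedSpace T] (f : C(T, X)) (t₀ : T)
    (τ : Path.Homotopic.Quotient x₀ (f t₀)) :
    ∃! l : (∀ t : T, Path.Homotopic.Quotient x₀ (f t)),
      l t₀ = τ ∧ ∀ (s t : T) (η : Path s t),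
        (l s).trans (Path.Homotopic.Quotient.mk (η.map f.continuous)) = l t := by
  refine ⟨fun t => Path.Homotopic.Quotient.trans τ
    (Path.Homotopic.Quotient.mk ((PathConnectedSpace.somePath t₀ t).map f.continuous)),
    ⟨?_, fun s t η => ?_⟩, ?_⟩
  · change Path.Homotopic.Quotient.trans τ _ = τ
    rw [Path.Homotopic.Quotient.eq.2 ((SimplyConnectedSpace.paths_homotopic
      (PathConnectedSpace.somePath t₀ t₀) (Path.refl _)).map f)]
    exact Path.Homotopic.Quotient.trans_refl _
  · rw [Path.Homotopic.Quotient.trans_assoc, ← Path.Homotopic.Quotient.mk_trans, ← Path.map_trans]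
    congr 1
    exact Path.Homotopic.Quotient.eq.2 ((SimplyConnectedSpace.paths_homotopic _ _).map f)
  · rintro l ⟨rfl, h⟩
    funext t
    exact (h _ _ _).symm

end LiftedMap

/-! ## The chain complex of the universal cover -/

section Chains

variable (X : Type*) [TopologicalSpace X] (x₀ : X)

/-- The singular `n`-simplices of the universal cover `X̃`. -/
abbrev CoverSimplex (n : ℕ) : Type _ := LiftedMap (stdSimplex ℝ (Fin (n + 1))) X x₀

/-- The inclusion of the `i`-th face (opposite to the vertex `i`) into the standard simplex. -/
def faceInclusion (n : ℕ) (i : Fin (n + 2)) :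
    C(stdSimplex ℝ (Fin (n + 1)), stdSimplex ℝ (Fin (n + 2))) :=
  ⟨stdSimplex.map i.succAbove, stdSimplex.continuous_map _⟩

/-- The group `C_n(X̃, ℤ)` of singular chains of the universal cover. -/
abbrev CoverChain (n : ℕ) : Type _ := CoverSimplex X x₀ n →₀ ℤ

/-- The left action of the group ring of `π₁(X, x₀)` on `C_n(X̃, ℤ)`, on group elements. -/
def coverAct (n : ℕ) (g : Pi1 X x₀) : CoverChain X x₀ n →ₗ[ℤ] CoverChain X x₀ n :=
  Finsupp.lmapDomain ℤ ℤ (g • ·)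

/-- The boundary map `C_{n+1}(X̃, ℤ) → C_n(X̃, ℤ)`, the alternating sum of the faces. -/
def coverBoundary (n : ℕ) : CoverChain X x₀ (n + 1) →ₗ[ℤ] CoverChain X x₀ n :=
  ∑ i : Fin (n + 2), (-1 : ℤ) ^ (i : ℕ) •
    Finsupp.lmapDomain ℤ ℤ (fun σ : CoverSimplex X x₀ (n + 1) => σ.comp (faceInclusion n i))

variable {X x₀}

theorem coverBoundary_single (n : ℕ) (σ : CoverSimplex X x₀ (n + 1)) (a : ℤ) :
    coverBoundary X x₀ n (Finsupp.single σ a) =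
      ∑ i : Fin (n + 2), (-1 : ℤ) ^ (i : ℕ) • Finsupp.single (σ.comp (faceInclusion n i)) a := by
  simp [coverBoundary, LinearMap.sum_apply, Finsupp.mapDomain_single]

theorem coverBoundary_act (n : ℕ) (g : Pi1 X x₀) (c : CoverChain X x₀ (n + 1)) :
    coverBoundary X x₀ n (coverAct X x₀ (n + 1) g c) =
      coverAct X x₀ n g (coverBoundary X x₀ n c) := by
  induction c using Finsupp.induction_linear with
  | zero => simp
  | add c d hc hd => simp only [map_add, hc, hd]
  | single σ a =>
    have h : ∀ (m : ℕ) (τ : CoverSimplex X x₀ m) (b : ℤ),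
        coverAct X x₀ m g (Finsupp.single τ b) = Finsupp.single (g • τ) b := by
      intro m τ b
      simp [coverAct, Finsupp.mapDomain_single]
    rw [h, coverBoundary_single, coverBoundary_single, map_sum]
    refine Finset.sum_congr rfl fun i _ => ?_
    rw [map_smul, h, LiftedMap.smul_comp]

/-- The simplicial identity for iterated faces. -/
theorem comp_faceInclusion (n : ℕ) (i : Fin (n+2)) (j : Fin (n+3)) (h : (j:ℕ) ≤ i)
   (σ : CoverSimplex X x₀ (n+2)) :
   (σ.comp (faceInclusion (n+1) j)).comp (faceInclusion n i) =
   (σ.comp (faceInclusion (n+1) i.succ)).comp (faceInclusion n (j.castLT (by omega))) := by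
  change σ.comp ((faceInclusion (n+1) j).comp (faceInclusion n i)) =
   σ.comp ((faceInclusion (n+1) i.succ).comp (faceInclusion n (j.castLT (by omega))))
  congr 1
  ext1 t
  simp only [faceInclusion, ContinuousMap.comp_apply, ContinuousMap.coe_mk, stdSimplex.map_comp_apply]
  congr 1
  funext a
  apply Fin.ext
  simp only [Function.comp, Fin.succAbove, Fin.lt_def, Fin.val_castSucc, Fin.val_succ, Fin.val_castLT]
  split_ifs <;> simp_all <;> omega

/-- The boundary maps form a chain complex. -/
theorem coverBoundary_coverBoundary (n : ℕ) (c : CoverChain X x₀ (n + 2)) :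
    coverBoundary X x₀ n (coverBoundary X x₀ (n+1) c) = 0 := by
  induction c using Finsupp.induction_linear with
  | zero => simp
  | add c d hc hd => simp only [map_add, hc, hd, add_zero]
  | single σ a =>
  simp only [coverBoundary_single, map_sum, map_smul, Finset.smul_sum, smul_smul]
  rw [Finset.sum_comm, ← Finset.sum_product', Finset.univ_product_univ]
  let P := Fin (n + 2) × Fin (n + 3)
  let S : Finset P := {ij : P | (ij.2 : ℕ) ≤ (ij.1 : ℕ)}
  rw [← Finset.sum_add_sum_compl S, ← eq_neg_iff_add_eq_zero, ← Finset.sum_neg_distrib]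
  let φ : ∀ ij : P, ij ∈ S → P := fun ij hij =>
    (Fin.castLT ij.2 (lt_of_le_of_lt (Finset.mem_filter.mp hij).right (Fin.is_lt ij.1)), ij.1.succ)
  apply Finset.sum_bij φ
  · intro ij hij
    simp_rw [S, φ, Finset.compl_filter, Finset.mem_filter_univ, Fin.val_succ,
      Fin.val_castLT] at hij ⊢
    lia
  · rintro ⟨i, j⟩ hij ⟨i', j'⟩ hij' h
    rw [Prod.mk_inj]
    exact ⟨by simpa [φ] using! congr_arg Prod.snd h,
      by simpa [φ, Fin.castSucc_castLT] using! congr_arg Fin.castSucc (congr_arg Prod.fst h)⟩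
  · rintro ⟨i', j'⟩ hij'
    simp_rw [S, Finset.compl_filter, Finset.mem_filter_univ, not_le] at hij'
    refine ⟨(j'.pred <| ?_, Fin.castSucc i'), ?_, ?_⟩
    · rintro rfl
      simp only [Fin.val_zero, not_lt_zero] at hij'
    · simpa [S] using! Nat.le_sub_one_of_lt hij'
    · simp only [φ, Fin.castLT_castSucc, Fin.succ_pred]
  · rintro ⟨i, j⟩ hij
    have hij' : (j:ℕ) ≤ i := by simpa [S] using hij
    simp only [φ]
    rw [comp_faceInclusion n i j hij', ← neg_smul]
    congr 1
    simp [pow_succ, mul_comm]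

end Chains

/-! ## Homology with coefficients in a right module over the group ring

A right module over the group ring `ℤ[G]`, with values in modules over a commutative ring `S`, is
given as an `S`-module `A` with an `S`-linear right action of `G`, that is, a representation `r`
of the opposite group of `G`: the product `a · g` is `r (op g) a`. -/

section Coefficients

variable (X : Type*) [TopologicalSpace X] (x₀ : X)
variable {S A : Type*} [CommRing S] [AddCommGroup A] [Module S A]
variable (r : Representation S (Pi1 X x₀)ᵐᵒᵖ A)

/-- The relations `(a · g) ⊗ c = a ⊗ (g · c)` that turn the tensor product over `ℤ` into the tensor
product over the group ring of `π₁(X, x₀)`. -/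
def balancedRelations (n : ℕ) : Submodule S (A ⊗[ℤ] CoverChain X x₀ n) :=
  Submodule.span S {z | ∃ (a : A) (g : Pi1 X x₀) (c : CoverChain X x₀ n),
    z = r (MulOpposite.op g) a ⊗ₜ[ℤ] c - a ⊗ₜ[ℤ] coverAct X x₀ n g c}

/-- The chain module `C_n(X, A) = A ⊗_{ℤ[π₁(X)]} C_n(X̃, ℤ)`. -/
abbrev TwistedChain (n : ℕ) : Type _ :=
  (A ⊗[ℤ] CoverChain X x₀ n) ⧸ balancedRelations X x₀ r n

theorem balancedRelations_le (n : ℕ) :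
    balancedRelations X x₀ r (n + 1) ≤ (balancedRelations X x₀ r n).comap
      (TensorProduct.AlgebraTensorModule.lTensor S A (coverBoundary X x₀ n)) := by
  refine Submodule.span_le.2 ?_
  rintro _ ⟨a, g, c, rfl⟩
  refine Submodule.subset_span ⟨a, g, coverBoundary X x₀ n c, ?_⟩
  simp only [map_sub, TensorProduct.AlgebraTensorModule.lTensor_tmul, coverBoundary_act]

/-- The boundary map `id_A ⊗ ∂ : C_{n+1}(X, A) → C_n(X, A)`. -/
def twistedBoundary (n : ℕ) : TwistedChain X x₀ r (n + 1) →ₗ[S] TwistedChain X x₀ r n :=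
  Submodule.mapQ _ _ (TensorProduct.AlgebraTensorModule.lTensor S A (coverBoundary X x₀ n))
    (balancedRelations_le X x₀ r n)

/-- The cycles in `C_n(X, A)`; in degree `0` every chain is a cycle. -/
def twistedCycles : ∀ n : ℕ, Submodule S (TwistedChain X x₀ r n)
  | 0 => ⊤
  | n + 1 => LinearMap.ker (twistedBoundary X x₀ r n)

/-- The boundaries in `C_n(X, A)`. -/
def twistedBoundaries (n : ℕ) : Submodule S (TwistedChain X x₀ r n) :=
  LinearMap.range (twistedBoundary X x₀ r n)

/-- The homology `H_n(X, A)` of `X` with coefficients in the right module `A`. -/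
abbrev TwistedHomology (n : ℕ) : Type _ :=
  twistedCycles X x₀ r n ⧸ (twistedBoundaries X x₀ r n).submoduleOf (twistedCycles X x₀ r n)

end Coefficients

/-! ## Characteristic varieties -/

section CharacteristicVarieties

/-- The rank one module `K_ρ` of a character `ρ : G → Kˣ`: the group element `g` acts on `K` as
multiplication by `ρ g`. -/
def charModule {G K : Type*} [Group G] [Field K] (ρ : G →* Kˣ) : Representation K Gᵐᵒᵖ K where
  toFun g := (ρ g.unop : K) • LinearMap.id
  map_one' := by ext; simp
  map_mul' g h := by ext; simp [mul_comm]

/-- The characteristic variety `V^i_d(X, K)`: the characters `ρ : π₁(X) → Kˣ` for which the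
dimension over `K` of `H_i(X, K_ρ)` is at least `d`. -/
def charVariety (X : Type*) [TopologicalSpace X] (x₀ : X) (K : Type*) [Field K] (i d : ℕ) :
    Set (Pi1 X x₀ →* Kˣ) :=
  {ρ | (d : Cardinal) ≤ Module.rank K (TwistedHomology X x₀ (charModule ρ) i)}

end CharacteristicVarieties

/-! ## The Novikov-Sikorav completion and the BNSR invariants -/

section Novikov

variable {G : Type*} [Group G]

/-- The Novikov-Sikorav completion of the integral group ring of `G` with respect to an additive
character `χ : G → ℝ`: the formal sums `∑ n_g g` with integer coefficients (encoded as the functions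
`g ↦ n_g`) such that for each real `c` only finitely many `g` satisfy `n_g ≠ 0` and `χ g ≥ c`. -/
def novikovCompletion (χ : Additive G →+ ℝ) : Submodule ℤ (G → ℤ) where
  carrier := {f | ∀ c : ℝ, {g : G | f g ≠ 0 ∧ c ≤ χ (Additive.ofMul g)}.Finite}
  zero_mem' c := by simp
  add_mem' {f f'} hf hf' c := by
    refine ((hf c).union (hf' c)).subset ?_
    rintro g ⟨hg, hc⟩
    by_cases h : f g = 0
    · exact Or.inr ⟨fun h' => hg (by simp [h, h']), hc⟩
    · exact Or.inl ⟨h, hc⟩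
  smul_mem' n f hf c := by
    refine (hf c).subset ?_
    rintro g ⟨hg, hc⟩
    exact ⟨fun h => hg (by simp [h]), hc⟩

/-- The Novikov-Sikorav completion as a right module over the group ring: multiplication on the
right by `h` sends `∑ n_g g` to `∑ n_g (g h)`, whose coefficient at `g` is `n_{g h⁻¹}`. -/
def novikovModule (χ : Additive G →+ ℝ) : Representation ℤ Gᵐᵒᵖ (novikovCompletion χ) where
  toFun h :=
    { toFun := fun f => ⟨fun g => f.1 (g * h.unop⁻¹), by
        intro c
        refine ((f.2 (c - χ (Additive.ofMul h.unop))).image (· * h.unop)).subset ?_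
        rintro g ⟨hg, hc⟩
        refine ⟨g * h.unop⁻¹, ⟨hg, ?_⟩, by simp⟩
        rw [ofMul_mul, ofMul_inv, map_add, map_neg]
        linarith⟩
      map_add' := fun _ _ => rfl
      map_smul' := fun _ _ => rfl }
  map_one' := by
    refine LinearMap.ext fun f => Subtype.ext <| funext fun g => ?_
    simp
  map_mul' h h' := by
    refine LinearMap.ext fun f => Subtype.ext <| funext fun g => ?_
    simp [mul_assoc]

/-- The Bieri-Neumann-Strebel-Renz invariant `Σ^q(X, ℤ)`: the nonzero additive characters `χ` of
`π₁(X)` such that the homology of `X` with coefficients in the Novikov-Sikorav completion with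
respect to `-χ` vanishes in all degrees up to `q`. -/
def sigmaInvariant (X : Type*) [TopologicalSpace X] (x₀ : X) (q : ℕ) :
    Set (Additive (Pi1 X x₀) →+ ℝ) :=
  {χ | χ ≠ 0 ∧ ∀ i ≤ q, Subsingleton (TwistedHomology X x₀ (novikovModule (-χ)) i)}

end Novikov

/-! ## Valuations and algebraic integers -/

/-- The homomorphism `Kˣ → ℝ` defined by a real (additively written) valuation on `K`, whose value
at `0` is infinite and whose values on `Kˣ` are real numbers. -/
def unitsValuation {K : Type*} [Field K] (v : AddValuation K (WithTop ℝ)) : Additive Kˣ →+ ℝ where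
  toFun u := (v (u.toMul : K)).untop (fun h => u.toMul.ne_zero (v.top_iff.1 h))
  map_zero' := by simp
  map_add' a b := by
    rw [← WithTop.coe_inj]
    simp [AddValuation.map_mul]

/-- The additive character `v ∘ ρ` of `G`, for a multiplicative character `ρ : G → Kˣ` and a
real valuation `v` on `K`. -/
def valuationComp {G K : Type*} [Group G] [Field K] (v : AddValuation K (WithTop ℝ))
    (ρ : G →* Kˣ) : Additive G →+ ℝ :=
  (unitsValuation v).comp (MonoidHom.toAdditive ρ)

/-- A multiplicative character `ρ : Γ → Kˣ` of a subgroup `Γ` of `ℝ` is an algebraic integer if it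
is a root of some `Δ = ∑ n_γ γ` in the integral group ring of `Γ` whose coefficient at the greatest
element `γ₀` of its support (for the order of `ℝ`) is `1`. -/
def IsAlgebraicInteger {Γ : AddSubgroup ℝ} {K : Type*} [Field K]
    (ρ : Multiplicative Γ →* Kˣ) : Prop :=
  ∃ (Δ : AddMonoidAlgebra ℤ Γ) (γ₀ : Γ), IsGreatest {γ : Γ | Δ.coeff γ ≠ 0} γ₀ ∧ Δ.coeff γ₀ = 1 ∧
    AddMonoidAlgebra.lift ℤ K Γ ((Units.coeHom K).comp ρ) Δ = 0

/-- The pullback `ρ ∘ ξ` of a multiplicative character `ρ` of the image `Γ` of an additive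
character `χ = ι ∘ ξ : G → ℝ` along the corestriction `ξ : G → Γ` of `χ`. -/
def pullbackChar {G K : Type*} [Group G] [Field K] (χ : Additive G →+ ℝ)
    (ρ : Multiplicative χ.range →* Kˣ) : G →* Kˣ :=
  ρ.comp (AddMonoidHom.toMultiplicativeRight χ.rangeRestrict)

end BNSR

end

set_option linter.unusedSectionVars false

open Topology TensorProduct

noncomputable section

/-! Both parts follow from one principle. Let `A` be the completion of ℤG whose homology vanishes up
to degree q, and suppose there is an additive map θ : A → K with θ(1) = 1 and θ(ga) = θ(ag) =
ρ(g)θ(a). It need not be multiplicative. The chains C of the universal cover are free over ℤG, so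
the vanishing allows one to contract the map c ↦ 1 ⊗ c from C to A ⊗ C, equivariantly and up to
degree q. Applying θ gives a contraction of the complex with coefficients in K_ρ, whose homology
therefore vanishes (`subsingleton_homology_of_linear_map`). It remains to construct θ.

For part 1, the sums of n_g ρ(g) over v(ρ(g)) ≤ t are Cauchy as t grows. Since K need not be
complete, the limit is replaced by a K-linear functional on functions ℝ → K that sends 1 to 1 and
kills null functions (`exists_generalized_limit`). Multiplying by g scales the sums by ρ(g) and
shifts t, which changes them only by a null function.

For part 2, θ factors through the ring H of Hahn series over Γ, with exponents negated. Let p be the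
kernel of evaluation ℤΓ → K at ρ; that ρ is not an algebraic integer means that no element of p has
leading coefficient 1. The central claim is that p is contracted from a prime P of H
(`exists_prime_comap_eq`). Then Frac(ℤΓ/p) embeds in K and in Frac(H/P), and a linear retraction of
Frac(H/P) onto it yields θ. The claim rests on `exists_mul_mem_span`: up to multipliers with leading
coefficient 1, which are units of H, a nonzero ideal of ℤΓ is generated by a single a whose leading
coefficient divides all others. Cancelling leading terms puts each element in (a) + mⁿ for all n,
inside a Noetherian monoid ring, and Krull's intersection theorem concludes. -/

namespace BNSR

/-! ### Leading terms in the group ring of an ordered group. -/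

section LeadingTerms

variable {Λ : Type*} [AddCommGroup Λ] [LinearOrder Λ] [IsOrderedAddMonoid Λ]

/-- The inclusion of the group ring of an ordered group into the ring of Hahn series. -/
def groupRingToHahn (Λ : Type*) [AddCommGroup Λ] [LinearOrder Λ] [IsOrderedAddMonoid Λ] :
    AddMonoidAlgebra ℤ Λ →ₐ[ℤ] HahnSeries Λ ℤ :=
  AddMonoidAlgebra.lift ℤ (HahnSeries Λ ℤ) Λ
    { toFun := fun γ => HahnSeries.single γ.toAdd 1
      map_one' := rfl
      map_mul' := fun γ δ => by simp [HahnSeries.single_mul_single] }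

theorem groupRingToHahn_single (γ : Λ) (n : ℤ) :
    groupRingToHahn Λ (AddMonoidAlgebra.single γ n) = HahnSeries.single γ n := by
  rw [groupRingToHahn, AddMonoidAlgebra.lift_single]
  change n • HahnSeries.single γ (1 : ℤ) = _
  ext δ
  by_cases h : δ = γ
  · rw [HahnSeries.coeff_smul, h, HahnSeries.coeff_single_same, HahnSeries.coeff_single_same,
      smul_eq_mul, mul_one]
  · rw [HahnSeries.coeff_smul, HahnSeries.coeff_single_of_ne h, HahnSeries.coeff_single_of_ne h,
      smul_zero]

theorem groupRingToHahn_coeff (x : AddMonoidAlgebra ℤ Λ) (γ : Λ) :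
    (groupRingToHahn Λ x).coeff γ = x.coeff γ := by
  classical
  induction x using AddMonoidAlgebra.induction_linear with
  | zero => simp
  | add x y hx hy => simp [hx, hy]
  | single δ n =>
    rw [groupRingToHahn_single, AddMonoidAlgebra.coeff_single, Finsupp.single_apply]
    split_ifs with h
    · rw [h, HahnSeries.coeff_single_same]
    · exact HahnSeries.coeff_single_of_ne (Ne.symm h)

theorem groupRingToHahn_injective : Function.Injective (groupRingToHahn Λ) := by
  intro x y h
  ext γ
  rw [← groupRingToHahn_coeff, h, groupRingToHahn_coeff]

theorem order_eq_of_coeff {x : HahnSeries Λ ℤ} {γ : Λ} (h : x.coeff γ ≠ 0)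
    (h' : ∀ δ < γ, x.coeff δ = 0) : x.order = γ := by
  refine le_antisymm (HahnSeries.order_le_of_coeff_ne_zero h) (not_lt.1 fun hlt => ?_)
  have hx : x ≠ 0 := by rintro rfl; simp at h
  exact HahnSeries.coeff_order_eq_zero.not.2 hx (h' _ hlt)

/-- The leading coefficient of an element of the group ring. -/
def lc (x : AddMonoidAlgebra ℤ Λ) : ℤ := (groupRingToHahn Λ x).leadingCoeff

theorem lc_mul (x y : AddMonoidAlgebra ℤ Λ) : lc (x * y) = lc x * lc y := by
  rw [lc, map_mul, HahnSeries.leadingCoeff_mul]; rfl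

theorem lc_single (γ : Λ) (n : ℤ) : lc (AddMonoidAlgebra.single γ n) = n := by
  rw [lc, groupRingToHahn_single]; simp

theorem lc_eq_zero {x : AddMonoidAlgebra ℤ Λ} : lc x = 0 ↔ x = 0 := by
  rw [lc, HahnSeries.leadingCoeff_eq_zero, map_eq_zero_iff _ groupRingToHahn_injective]

end LeadingTerms

/-! ### Monoid rings of finitely generated positive monoids. -/

section PositiveMonoid

variable {Λ : Type*} [AddCommGroup Λ] [LinearOrder Λ] [IsOrderedAddMonoid Λ]

theorem nonneg_of_mem_closure {F : Finset Λ} (hF : ∀ f ∈ F, 0 < f) {γ : Λ}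
    (hγ : γ ∈ AddSubmonoid.closure (F : Set Λ)) : 0 ≤ γ := by
  induction hγ using AddSubmonoid.closure_induction with
  | mem x hx => exact (hF x hx).le
  | zero => exact le_rfl
  | add x y _ _ hx hy => exact add_nonneg hx hy

/-- In a sum of generators bounded by `c`, each generator occurs at most as often as the Archimedean
property allows, because the other summands are nonnegative. -/
theorem finite_closure_le [Archimedean Λ] {F : Finset Λ} (hF : ∀ f ∈ F, 0 < f) (c : Λ) :
    {γ | γ ∈ AddSubmonoid.closure (F : Set Λ) ∧ γ ≤ c}.Finite := by
  choose N hN using fun f : F => Archimedean.arch c (hF f f.2)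
  refine ((Set.finite_Iic N).image fun n : F → ℕ => ∑ f, n f • (f : Λ)).subset ?_
  rintro γ ⟨hγ, hc⟩
  obtain ⟨n, -, rfl⟩ := AddSubmonoid.mem_closure_finset.1 hγ
  refine ⟨fun f => n f, fun f => ?_, ?_⟩
  · have h1 : n f • (f : Λ) ≤ N f • (f : Λ) := by
      refine le_trans ?_ (hc.trans (hN f))
      exact Finset.single_le_sum (f := fun a => n a • a)
        (fun a ha => nsmul_nonneg (hF a ha).le _) f.2
    exact (nsmul_le_nsmul_iff_left (hF f f.2)).1 h1
  · exact Finset.sum_coe_sort F fun a => n a • a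

variable (F : Finset Λ)

/-- The ideal of the monoid ring that is generated by the given generators of the monoid. -/
def generatorIdeal : Ideal (AddMonoidAlgebra ℤ (AddSubmonoid.closure (F : Set Λ))) :=
  Ideal.span {x | ∃ f : AddSubmonoid.closure (F : Set Λ), (f : Λ) ∈ F ∧
    x = AddMonoidAlgebra.single f 1}

/-- The inclusion of the monoid ring in the group ring. -/
def monoidRingInclusion : AddMonoidAlgebra ℤ (AddSubmonoid.closure (F : Set Λ)) →+*
    AddMonoidAlgebra ℤ Λ :=
  AddMonoidAlgebra.mapDomainRingHom ℤ (AddSubmonoid.closure (F : Set Λ)).subtype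

variable {F}

theorem monoidRingInclusion_single (γ : AddSubmonoid.closure (F : Set Λ)) (n : ℤ) :
    monoidRingInclusion F (AddMonoidAlgebra.single γ n) = AddMonoidAlgebra.single (γ : Λ) n := by
  simp [monoidRingInclusion]

theorem monoidRingInclusion_coeff (x : AddMonoidAlgebra ℤ (AddSubmonoid.closure (F : Set Λ)))
    (γ : AddSubmonoid.closure (F : Set Λ)) :
    (monoidRingInclusion F x).coeff γ = x.coeff γ :=
  Finsupp.mapDomain_apply Subtype.val_injective _ _

theorem monoidRingInclusion_coeff_of_notMem
    (x : AddMonoidAlgebra ℤ (AddSubmonoid.closure (F : Set Λ)))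
    {γ : Λ} (hγ : γ ∉ AddSubmonoid.closure (F : Set Λ)) :
    (monoidRingInclusion F x).coeff γ = 0 :=
  Finsupp.mapDomain_of_notMem_range _ _ (by simpa using hγ)

/-- `N` is the number of generators in an expression of `γ`; each of them is at most the sum of `F`.
Hence large exponents lie in high powers of the ideal. -/
theorem exists_single_mem_pow (hF : ∀ f ∈ F, 0 < f) {γ : Λ}
    (hγ : γ ∈ AddSubmonoid.closure (F : Set Λ)) :
    ∃ N : ℕ, γ ≤ N • ∑ f ∈ F, f ∧ AddMonoidAlgebra.single ⟨γ, hγ⟩ 1 ∈ generatorIdeal F ^ N := by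
  induction hγ using AddSubmonoid.closure_induction with
  | mem x hx =>
    refine ⟨1, ?_, ?_⟩
    · rw [one_smul]
      exact Finset.single_le_sum (f := fun a => a) (fun a ha => (hF a ha).le) hx
    · rw [pow_one]
      exact Ideal.subset_span ⟨_, hx, rfl⟩
  | zero => exact ⟨0, by simp, by simp⟩
  | add x y hx hy ihx ihy =>
    obtain ⟨N, hN, hN'⟩ := ihx
    obtain ⟨N', hN1, hN2⟩ := ihy
    refine ⟨N + N', ?_, ?_⟩
    · rw [add_smul]; exact add_le_add hN hN1
    · rw [pow_add]
      have := Ideal.mul_mem_mul hN' hN2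
      rwa [AddMonoidAlgebra.single_mul_single, one_mul] at this

theorem single_mem_pow (hF : ∀ f ∈ F, 0 < f) (n : ℕ)
    {γ : AddSubmonoid.closure (F : Set Λ)} (hn : n • ∑ f ∈ F, f < (γ : Λ)) (k : ℤ) :
    AddMonoidAlgebra.single γ k ∈ generatorIdeal F ^ n := by
  obtain ⟨N, hN, hN'⟩ := exists_single_mem_pow hF γ.2
  have h0 : 0 ≤ ∑ f ∈ F, f := Finset.sum_nonneg fun f hf => (hF f hf).le
  have hlt : n < N := by
    by_contra! h
    exact absurd (hn.trans_le hN) (not_lt.2 (nsmul_le_nsmul_left h0 h))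
  have h1 := Ideal.pow_le_pow_right hlt.le hN'
  have h2 := Submodule.smul_of_tower_mem (generatorIdeal F ^ n) k h1
  rwa [AddMonoidAlgebra.smul_single, smul_eq_mul, mul_one] at h2

theorem mem_pow_of_coeff (hF : ∀ f ∈ F, 0 < f) (n : ℕ)
    {x : AddMonoidAlgebra ℤ (AddSubmonoid.closure (F : Set Λ))}
    (hx : ∀ γ, x.coeff γ ≠ 0 → n • ∑ f ∈ F, f < (γ : Λ)) : x ∈ generatorIdeal F ^ n := by
  rw [← AddMonoidAlgebra.sum_coeff_single x]
  exact Ideal.sum_mem _ fun γ hγ => single_mem_pow hF n (hx γ (Finsupp.mem_support_iff.1 hγ)) _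

/-- Nonnegative exponents add up to zero only if both vanish, so multiplication cannot create a
constant term. -/
theorem coeff_zero_of_mem_generatorIdeal (hF : ∀ f ∈ F, 0 < f)
    {x : AddMonoidAlgebra ℤ (AddSubmonoid.closure (F : Set Λ))}
    (hx : x ∈ generatorIdeal F) : x.coeff 0 = 0 := by
  induction hx using Submodule.span_induction with
  | mem x hx =>
    obtain ⟨f, hf, rfl⟩ := hx
    rw [AddMonoidAlgebra.coeff_single, Finsupp.single_apply, if_neg]
    rintro rfl
    exact (hF _ hf).ne rfl
  | zero => simp
  | add x y _ _ hx hy => simp [hx, hy]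
  | smul a x hx ih =>
    classical
    rw [smul_eq_mul, AddMonoidAlgebra.coeff_mul]
    refine Finset.sum_eq_zero fun γ _ => Finset.sum_eq_zero fun δ _ => ?_
    dsimp only
    split_ifs with h
    · have h' : (γ : Λ) + δ = 0 := congrArg Subtype.val h
      have h1 := nonneg_of_mem_closure hF γ.2
      have h2 := nonneg_of_mem_closure hF δ.2
      have h3 : δ = 0 := Subtype.ext (le_antisymm
        ((le_add_of_nonneg_left h1).trans_eq h') h2)
      rw [h3, ih, mul_zero]
    · rfl

theorem order_mem_closure {x : AddMonoidAlgebra ℤ (AddSubmonoid.closure (F : Set Λ))}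
    (hx : x ≠ 0) : (groupRingToHahn Λ (monoidRingInclusion F x)).order ∈
      AddSubmonoid.closure (F : Set Λ) := by
  by_contra h
  have h1 : monoidRingInclusion F x ≠ 0 := by
    rw [Ne, map_eq_zero_iff _ (AddMonoidAlgebra.mapDomain_injective Subtype.val_injective)]
    exact hx
  have h2 : groupRingToHahn Λ (monoidRingInclusion F x) ≠ 0 := by
    rwa [Ne, map_eq_zero_iff _ groupRingToHahn_injective]
  refine HahnSeries.coeff_order_eq_zero.not.2 h2 ?_
  rw [groupRingToHahn_coeff, monoidRingInclusion_coeff_of_notMem _ h]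

end PositiveMonoid

/-! ### Division by leading terms, Krull's intersection theorem and extension to Hahn series. -/

section Krull

variable {Λ : Type*} [AddCommGroup Λ] [LinearOrder Λ] [IsOrderedAddMonoid Λ]

/-- The exponent of the leading term of an element of the group ring. -/
def ord (x : AddMonoidAlgebra ℤ Λ) : Λ := (groupRingToHahn Λ x).order

theorem coeff_ord (x : AddMonoidAlgebra ℤ Λ) : x.coeff (ord x) = lc x := by
  rw [lc, HahnSeries.leadingCoeff_eq, groupRingToHahn_coeff]; rfl

theorem coeff_eq_zero_of_lt_ord {x : AddMonoidAlgebra ℤ Λ} {γ : Λ} (h : γ < ord x) :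
    x.coeff γ = 0 := by
  rw [← groupRingToHahn_coeff]
  exact HahnSeries.coeff_eq_zero_of_lt_order h

theorem ord_eq_of_coeff {x : AddMonoidAlgebra ℤ Λ} {γ : Λ} (h : x.coeff γ ≠ 0)
    (h' : ∀ δ < γ, x.coeff δ = 0) : ord x = γ :=
  order_eq_of_coeff (by rwa [groupRingToHahn_coeff])
    fun δ hδ => by rw [groupRingToHahn_coeff, h' δ hδ]

theorem lc_eq_of_coeff {x : AddMonoidAlgebra ℤ Λ} {γ : Λ} (h : x.coeff γ ≠ 0)
    (h' : ∀ δ < γ, x.coeff δ = 0) : lc x = x.coeff γ := by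
  rw [← coeff_ord, ord_eq_of_coeff h h']

theorem ord_single_mul (γ : Λ) {x : AddMonoidAlgebra ℤ Λ} (hx : x ≠ 0) {n : ℤ} (hn : n ≠ 0) :
    ord (AddMonoidAlgebra.single γ n * x) = γ + ord x := by
  have hx' : groupRingToHahn Λ x ≠ 0 := by
    rwa [Ne, map_eq_zero_iff _ groupRingToHahn_injective]
  rw [ord, map_mul, groupRingToHahn_single, HahnSeries.order_mul (by simpa using hn) hx',
    HahnSeries.order_single hn]
  rfl

/-- Cancelling the leading term. -/
theorem lt_ord_sub {x y : AddMonoidAlgebra ℤ Λ} (ho : ord x = ord y) (hl : lc x = lc y)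
    (h : x - y ≠ 0) : ord x < ord (x - y) := by
  have h1 : (x - y).coeff (ord (x - y)) ≠ 0 := by
    rw [coeff_ord]; exact fun h' => h (lc_eq_zero.1 h')
  rw [AddMonoidAlgebra.coeff_sub, Finsupp.sub_apply] at h1
  rcases lt_trichotomy (ord x) (ord (x - y)) with h2 | h2 | h2
  · exact h2
  · rw [← h2, coeff_ord, ho, coeff_ord, hl, sub_self] at h1
    exact absurd rfl h1
  · rw [coeff_eq_zero_of_lt_ord h2, coeff_eq_zero_of_lt_ord (ho ▸ h2), sub_self] at h1
    exact absurd rfl h1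

variable {F : Finset Λ}

/-- A division algorithm: a multiple of `a` cancels the leading term of `x` and raises its order.
Only finitely many orders are at most `c`, and their number is the induction measure; past `c` every
term lies in the power of the ideal. -/
theorem mem_span_sup_pow [Archimedean Λ] (hF : ∀ f ∈ F, 0 < f)
    (J : Ideal (AddMonoidAlgebra ℤ (AddSubmonoid.closure (F : Set Λ))))
    {a : AddMonoidAlgebra ℤ (AddSubmonoid.closure (F : Set Λ))} (haJ : a ∈ J)
    (ha0 : a ≠ 0) (hao : ord (monoidRingInclusion F a) = 0)
    (hdvd : ∀ x ∈ J, lc (monoidRingInclusion F a) ∣ lc (monoidRingInclusion F x)) (n : ℕ)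
    {x : AddMonoidAlgebra ℤ (AddSubmonoid.closure (F : Set Λ))} (hx : x ∈ J) :
    x ∈ Ideal.span {a} ⊔ generatorIdeal F ^ n := by
  classical
  set c := n • ∑ f ∈ F, f
  have hinj : Function.Injective (monoidRingInclusion F) :=
    AddMonoidAlgebra.mapDomain_injective Subtype.val_injective
  have hfin := finite_closure_le hF c
  induction hk : (hfin.toFinset.filter fun γ => ord (monoidRingInclusion F x) ≤ γ).card
    using Nat.strong_induction_on generalizing x with
  | _ k ih =>
  subst hk
  by_cases hx0 : x = 0
  · rw [hx0]; exact Submodule.zero_mem _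
  have hx1 : monoidRingInclusion F x ≠ 0 := (map_ne_zero_iff _ hinj).2 hx0
  have ha1 : monoidRingInclusion F a ≠ 0 := (map_ne_zero_iff _ hinj).2 ha0
  by_cases hc : c < ord (monoidRingInclusion F x)
  · refine Submodule.mem_sup_right (mem_pow_of_coeff hF n fun γ hγ => ?_)
    rw [← monoidRingInclusion_coeff] at hγ
    by_contra! h
    exact hγ (coeff_eq_zero_of_lt_ord (h.trans_lt hc))
  · obtain ⟨u, hu⟩ := hdvd x hx
    have hu0 : u ≠ 0 := by
      rintro rfl
      rw [mul_zero] at hu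
      exact hx1 (lc_eq_zero.1 hu)
    let γ : AddSubmonoid.closure (F : Set Λ) :=
      ⟨ord (monoidRingInclusion F x), order_mem_closure hx0⟩
    have hmap : monoidRingInclusion F (AddMonoidAlgebra.single γ u * a) =
        AddMonoidAlgebra.single (ord (monoidRingInclusion F x)) u * monoidRingInclusion F a := by
      rw [map_mul, monoidRingInclusion_single]
    have key : x - AddMonoidAlgebra.single γ u * a ∈ Ideal.span {a} ⊔ generatorIdeal F ^ n := by
      by_cases hz : x - AddMonoidAlgebra.single γ u * a = 0
      · rw [hz]; exact Submodule.zero_mem _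
      have hlt : ord (monoidRingInclusion F x) <
          ord (monoidRingInclusion F (x - AddMonoidAlgebra.single γ u * a)) := by
        rw [map_sub]
        refine lt_ord_sub ?_ ?_ ?_
        · rw [hmap, ord_single_mul _ ha1 hu0, hao, add_zero]
        · rw [hmap, lc_mul, lc_single, hu, mul_comm]
        · rw [← map_sub]; exact (map_ne_zero_iff _ hinj).2 hz
      refine ih _ (Finset.card_lt_card ?_) (J.sub_mem hx (J.mul_mem_left _ haJ)) rfl
      refine Finset.ssubset_iff_of_subset ?_ |>.2 ?_
      · intro δ hδ
        rw [Finset.mem_filter] at hδ ⊢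
        exact ⟨hδ.1, hlt.le.trans hδ.2⟩
      · refine ⟨γ, ?_, ?_⟩
        · simp only [Finset.mem_filter, Set.Finite.mem_toFinset, Set.mem_ofPred_eq]
          exact ⟨⟨γ.2, not_lt.1 hc⟩, le_rfl⟩
        · simp only [Finset.mem_filter, not_and, not_le]
          exact fun _ => hlt
    have h2 : AddMonoidAlgebra.single γ u * a ∈ Ideal.span {a} ⊔ generatorIdeal F ^ n :=
      Submodule.mem_sup_left (Ideal.mul_mem_left _ _ (Ideal.mem_span_singleton_self a))
    simpa using Submodule.add_mem _ key h2

/-- Rationality: if the leading coefficient of `a ∈ J` divides all leading coefficients of elements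
of `J`, then `J` is, up to elements with leading coefficient `1`, generated by `a`. -/
theorem exists_mul_mem_span_of_closure [Archimedean Λ] (hF : ∀ f ∈ F, 0 < f)
    (J : Ideal (AddMonoidAlgebra ℤ (AddSubmonoid.closure (F : Set Λ))))
    {a : AddMonoidAlgebra ℤ (AddSubmonoid.closure (F : Set Λ))} (haJ : a ∈ J)
    (ha0 : a ≠ 0) (hao : ord (monoidRingInclusion F a) = 0)
    (hdvd : ∀ x ∈ J, lc (monoidRingInclusion F a) ∣ lc (monoidRingInclusion F x))
    {x : AddMonoidAlgebra ℤ (AddSubmonoid.closure (F : Set Λ))} (hx : x ∈ J) :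
    ∃ s, lc (monoidRingInclusion F s) = 1 ∧ s * x ∈ Ideal.span {a} := by
  have hFG : AddMonoid.FG (AddSubmonoid.closure (F : Set Λ)) :=
    (AddMonoid.fg_iff_addSubmonoid_fg _).2 ⟨F, rfl⟩
  have hft : Algebra.FiniteType ℤ (AddMonoidAlgebra ℤ (AddSubmonoid.closure (F : Set Λ))) :=
    inferInstance
  have hN : IsNoetherianRing (AddMonoidAlgebra ℤ (AddSubmonoid.closure (F : Set Λ))) :=
    Algebra.FiniteType.isNoetherianRing ℤ _
  -- The class of `x` modulo `a` lies in every power of the ideal times the quotient, so Krull's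
  -- theorem provides `r` in the ideal that fixes this class.
  have hmem : (Ideal.Quotient.mk (Ideal.span {a}) x) ∈
      (⨅ i : ℕ, generatorIdeal F ^ i • ⊤ :
        Submodule (AddMonoidAlgebra ℤ (AddSubmonoid.closure (F : Set Λ)))
        (AddMonoidAlgebra ℤ (AddSubmonoid.closure (F : Set Λ)) ⧸ Ideal.span {a})) := by
    rw [Submodule.mem_iInf]
    intro n
    obtain ⟨y, hy, t, ht, rfl⟩ :=
      Submodule.mem_sup.1 (mem_span_sup_pow hF J haJ ha0 hao hdvd n hx)
    rw [map_add, Ideal.Quotient.eq_zero_iff_mem.2 hy, zero_add]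
    have : Ideal.Quotient.mk (Ideal.span {a}) t = t • Ideal.Quotient.mk (Ideal.span {a}) 1 := by
      change Ideal.Quotient.mk (Ideal.span {a}) t = Ideal.Quotient.mk (Ideal.span {a}) (t • 1)
      rw [smul_eq_mul, mul_one]
    rw [this]
    exact Submodule.smul_mem_smul ht trivial
  obtain ⟨r, hr⟩ := (Ideal.mem_iInf_smul_pow_eq_bot_iff _ _).1 hmem
  -- `r` has no constant term and all exponents are nonnegative, so `1 - r` has leading term 1.
  refine ⟨1 - r, ?_, ?_⟩
  · have h0 : (monoidRingInclusion F (1 - r)).coeff 0 = 1 := by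
      have := monoidRingInclusion_coeff (F := F) (1 - r) 0
      rw [ZeroMemClass.coe_zero] at this
      rw [this, AddMonoidAlgebra.coeff_sub, Finsupp.sub_apply,
        coeff_zero_of_mem_generatorIdeal hF r.2, AddMonoidAlgebra.one_def]
      simp
    rw [lc_eq_of_coeff (γ := 0) (by rw [h0]; exact one_ne_zero), h0]
    exact fun δ hδ => monoidRingInclusion_coeff_of_notMem _
      fun h => absurd (nonneg_of_mem_closure hF h) (not_le.2 hδ)
  · have hr' : (r : AddMonoidAlgebra ℤ (AddSubmonoid.closure (F : Set Λ))) •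
        (Ideal.Quotient.mk (Ideal.span {a}) x) = Ideal.Quotient.mk (Ideal.span {a}) x := hr
    rw [← Ideal.Quotient.eq_zero_iff_mem, sub_mul, one_mul, map_sub, map_mul, sub_eq_zero]
    exact hr'.symm

/-- The group ring need not be Noetherian, but only the exponents of `a` and `x` matter. Translated
to order 0, both elements live in the monoid ring on their finitely many positive exponents, to
which the ideal is contracted. -/
theorem exists_mul_mem_span [Archimedean Λ] (I : Ideal (AddMonoidAlgebra ℤ Λ))
    {a : AddMonoidAlgebra ℤ Λ} (haI : a ∈ I) (ha0 : a ≠ 0)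
    (hdvd : ∀ x ∈ I, lc a ∣ lc x) {x : AddMonoidAlgebra ℤ Λ} (hx : x ∈ I) :
    ∃ s, lc s = 1 ∧ s * x ∈ Ideal.span {a} := by
  classical
  by_cases hx0 : x = 0
  · exact ⟨1, by rw [AddMonoidAlgebra.one_def, lc_single], by rw [hx0, mul_zero]; exact zero_mem _⟩
  have hshift : ∀ y : AddMonoidAlgebra ℤ Λ, y ≠ 0 →
      ord (AddMonoidAlgebra.single (-ord y) 1 * y) = 0 := fun y hy => by
    rw [ord_single_mul _ hy one_ne_zero, neg_add_cancel]
  set a' := AddMonoidAlgebra.single (-ord a) 1 * a with ha'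
  set x' := AddMonoidAlgebra.single (-ord x) 1 * x with hx'
  let F : Finset Λ := (a'.coeff.support ∪ x'.coeff.support).erase 0
  have hpos : ∀ y : AddMonoidAlgebra ℤ Λ, ord y = 0 → ∀ γ ∈ y.coeff.support, γ ≠ 0 → 0 < γ := by
    intro y hy γ hγ hγ0
    refine lt_of_le_of_ne (not_lt.1 fun h => ?_) hγ0.symm
    exact Finsupp.mem_support_iff.1 hγ (coeff_eq_zero_of_lt_ord (hy.symm ▸ h))
  have hF : ∀ f ∈ F, 0 < f := by
    intro f hf
    obtain ⟨hf0, hf⟩ := Finset.mem_erase.1 hf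
    rcases Finset.mem_union.1 hf with hf | hf
    · exact hpos a' (hshift a ha0) f hf hf0
    · exact hpos x' (hshift x hx0) f hf hf0
  have hlift : ∀ y : AddMonoidAlgebra ℤ Λ, y.coeff.support ⊆ insert 0 F →
      ∃ z, monoidRingInclusion F z = y := by
    intro y hy
    refine ⟨AddMonoidAlgebra.comapDomain Subtype.val Subtype.val_injective y,
      AddMonoidAlgebra.mapDomain_comapDomain ?_ _⟩
    intro γ hγ
    rw [AddSubmonoid.coe_subtype, Subtype.range_coe]
    rcases Finset.mem_insert.1 (hy hγ) with h | h
    · rw [h]; exact zero_mem _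
    · exact AddSubmonoid.subset_closure h
  have hinsert : ∀ y : Finset Λ, y ⊆ a'.coeff.support ∪ x'.coeff.support → y ⊆ insert 0 F := by
    intro y hy γ hγ
    by_cases h : γ = 0
    · rw [h]; exact Finset.mem_insert_self _ _
    · exact Finset.mem_insert_of_mem (Finset.mem_erase.2 ⟨h, hy hγ⟩)
  obtain ⟨b, hb⟩ := hlift a' (hinsert _ Finset.subset_union_left)
  obtain ⟨z, hz⟩ := hlift x' (hinsert _ Finset.subset_union_right)
  have hla : lc a' = lc a := by rw [ha', lc_mul, lc_single, one_mul]
  have ha'0 : a' ≠ 0 := fun h => ha0 (lc_eq_zero.1 (by rw [← hla, h, lc_eq_zero]))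
  obtain ⟨s, hs, hsz⟩ := exists_mul_mem_span_of_closure hF (I.comap (monoidRingInclusion F))
    (a := b) (by rw [Ideal.mem_comap, hb]; exact I.mul_mem_left _ haI)
    (by rintro rfl; exact ha'0 (by rw [← hb, map_zero])) (by rw [hb]; exact hshift a ha0)
    (fun y hy => by rw [hb, hla]; exact hdvd _ hy)
    (x := z) (by rw [Ideal.mem_comap, hz]; exact I.mul_mem_left _ hx)
  refine ⟨monoidRingInclusion F s, hs, ?_⟩
  obtain ⟨w, hw⟩ := Ideal.mem_span_singleton'.1 hsz
  have hw' := congrArg (monoidRingInclusion F) hw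
  rw [map_mul, map_mul, hb, hz] at hw'
  rw [Ideal.mem_span_singleton']
  refine ⟨AddMonoidAlgebra.single (ord x) 1 * monoidRingInclusion F w *
    AddMonoidAlgebra.single (-ord a) 1, ?_⟩
  have h1 : AddMonoidAlgebra.single (ord x) 1 * x' = x := by
    rw [hx', ← mul_assoc, AddMonoidAlgebra.single_mul_single, add_neg_cancel, one_mul,
      ← AddMonoidAlgebra.one_def, one_mul]
  rw [mul_assoc, mul_assoc, ← ha', hw', mul_left_comm, h1]

/-- A nonzero ideal contains an element whose leading coefficient divides all others. -/
theorem exists_lc_dvd (I : Ideal (AddMonoidAlgebra ℤ Λ)) (hI : I ≠ ⊥) :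
    ∃ a ∈ I, a ≠ 0 ∧ ∀ x ∈ I, lc a ∣ lc x := by
  classical
  obtain ⟨y, hy, hy0⟩ := Submodule.exists_mem_ne_zero_of_ne_bot hI
  have hex : ∃ n : ℕ, ∃ a ∈ I, a ≠ 0 ∧ (lc a).natAbs = n := ⟨_, y, hy, hy0, rfl⟩
  obtain ⟨a, haI, ha0, han⟩ := Nat.find_spec hex
  refine ⟨a, haI, ha0, fun x hx => ?_⟩
  have hla : lc a ≠ 0 := fun h => ha0 (lc_eq_zero.1 h)
  by_cases hx0 : x = 0
  · rw [hx0, lc_eq_zero.2 rfl]; exact dvd_zero _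
  by_contra hnd
  have hr : lc x % lc a ≠ 0 := fun h => hnd (Int.dvd_of_emod_eq_zero h)
  -- With both leading terms moved to exponent 0, the leading coefficient of `z` is the remainder of
  -- the division, against the minimality of `lc a`.
  let z := AddMonoidAlgebra.single (-ord x) 1 * x -
    AddMonoidAlgebra.single (-ord a) (lc x / lc a) * a
  have hzI : z ∈ I := I.sub_mem (I.mul_mem_left _ hx) (I.mul_mem_left _ haI)
  have hcoeff : ∀ (w : AddMonoidAlgebra ℤ Λ) (n : ℤ) (δ : Λ),
      (AddMonoidAlgebra.single (-ord w) n * w).coeff δ = n * w.coeff (ord w + δ) := by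
    intro w n δ
    rw [← groupRingToHahn_coeff, map_mul, groupRingToHahn_single, HahnSeries.coeff_single_mul,
      groupRingToHahn_coeff, sub_neg_eq_add, add_comm]
  have hz0 : z.coeff 0 = lc x % lc a := by
    rw [AddMonoidAlgebra.coeff_sub, Finsupp.sub_apply, hcoeff, hcoeff, add_zero, add_zero,
      coeff_ord, coeff_ord, one_mul, Int.emod_def, mul_comm]
  have hzneg : ∀ δ < 0, z.coeff δ = 0 := by
    intro δ hδ
    rw [AddMonoidAlgebra.coeff_sub, Finsupp.sub_apply, hcoeff, hcoeff,
      coeff_eq_zero_of_lt_ord (add_lt_of_neg_right _ hδ),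
      coeff_eq_zero_of_lt_ord (add_lt_of_neg_right _ hδ), mul_zero, mul_zero, sub_zero]
  have hlz : lc z = lc x % lc a := by rw [lc_eq_of_coeff (γ := 0) (by rwa [hz0]) hzneg, hz0]
  have hlt : (lc z).natAbs < (lc a).natAbs := by
    rw [hlz]
    have h1 := Int.emod_nonneg (lc x) hla
    have h2 := Int.emod_lt_abs (lc x) hla
    rw [← Int.ofNat_lt, Int.natCast_natAbs, Int.natCast_natAbs, abs_of_nonneg h1]
    exact h2
  refine Nat.find_min hex (m := (lc z).natAbs) (by rw [← han]; exact hlt) ⟨z, hzI, ?_, rfl⟩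
  rintro hz
  rw [hz, lc_eq_zero.2 rfl] at hlz
  exact hr hlz.symm

theorem isUnit_groupRingToHahn {s : AddMonoidAlgebra ℤ Λ} (hs : lc s = 1) :
    IsUnit (groupRingToHahn Λ s) :=
  HahnSeries.isUnit_iff.2 (by
    rw [show (groupRingToHahn Λ s).leadingCoeff = 1 from hs]
    exact isUnit_one)

/-- A prime ideal of the group ring that has no element with leading coefficient `1` is the
contraction of a prime ideal of the ring of Hahn series. -/
theorem exists_prime_comap_eq [Archimedean Λ] (p : Ideal (AddMonoidAlgebra ℤ Λ)) [p.IsPrime]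
    (hp : ∀ s ∈ p, lc s ≠ 1) : ∃ P : Ideal (HahnSeries Λ ℤ), P.IsPrime ∧
      P.comap (groupRingToHahn Λ).toRingHom = p := by
  refine (Ideal.comap_map_eq_self_iff_of_isPrime p).1 (le_antisymm ?_ Ideal.le_comap_map)
  by_cases hbot : p = ⊥
  · rw [hbot, Ideal.map_bot]
    intro x hx
    exact (map_eq_zero_iff _ groupRingToHahn_injective).1 hx
  obtain ⟨a, hap, ha0, hdvd⟩ := exists_lc_dvd p hbot
  -- The multipliers `s` become units, so the extension of `p` is contained in the ideal generated
  -- by `a`.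
  have h1 : p.map (groupRingToHahn Λ).toRingHom ≤ Ideal.span {groupRingToHahn Λ a} := by
    rw [Ideal.map_le_iff_le_comap]
    intro x hx
    obtain ⟨s, hs, hsx⟩ := exists_mul_mem_span p hap ha0 hdvd hx
    obtain ⟨y, hy⟩ := Ideal.mem_span_singleton'.1 hsx
    rw [Ideal.mem_comap, ← Ideal.unit_mul_mem_iff_mem _ (isUnit_groupRingToHahn hs)]
    refine Ideal.mem_span_singleton'.2 ⟨groupRingToHahn Λ y, ?_⟩
    rw [← map_mul, hy, map_mul]; rfl
  intro x hx
  -- Leading coefficients of Hahn series multiply, so `lc a` also divides those in the contraction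
  -- of the ideal generated by `a`. Thus `s * x` is in `p`, while `s` is not.
  obtain ⟨s, hs, hsx⟩ := exists_mul_mem_span
    ((Ideal.span {groupRingToHahn Λ a}).comap (groupRingToHahn Λ).toRingHom) (a := a)
    (Ideal.mem_span_singleton_self _) ha0 (fun y hy => by
      obtain ⟨w, hw⟩ := Ideal.mem_span_singleton'.1 hy
      refine ⟨w.leadingCoeff, ?_⟩
      rw [mul_comm, lc, lc, ← HahnSeries.leadingCoeff_mul, hw]; rfl)
    (x := x) (Ideal.comap_mono h1 hx)
  have hsp : s * x ∈ p := (Ideal.span_singleton_le_iff_mem p).2 hap hsx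
  exact (Ideal.IsPrime.mem_or_mem ‹_› hsp).resolve_left fun h => hp s h hs

theorem exists_retraction {k E : Type*} [Field k] [Field E] (i : k →+* E) :
    ∃ l : E →+ k, l 1 = 1 ∧ ∀ c e, l (i c * e) = c * l e := by
  let _ : Algebra k E := i.toAlgebra
  obtain ⟨l, hl⟩ := (LinearMap.toSpanSingleton k E 1).exists_leftInverse_of_injective
    (LinearMap.ker_toSpanSingleton (R := k) (x := (1 : E)) one_ne_zero)
  refine ⟨l.toAddMonoidHom, ?_, fun c e => ?_⟩
  · have := LinearMap.congr_fun hl 1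
    simpa using this
  · change l (i c * e) = c * l e
    rw [← smul_eq_mul c, ← map_smul, Algebra.smul_def]
    rfl

/-- A homomorphism from the group ring to a field that does not vanish on the elements with leading
coefficient `1` extends linearly to the ring of Hahn series. -/
theorem exists_linear_extension [Archimedean Λ] {K : Type*} [Field K]
    (f : AddMonoidAlgebra ℤ Λ →+* K) (hf : ∀ s, f s = 0 → lc s ≠ 1) :
    ∃ θ : HahnSeries Λ ℤ →+ K, θ 1 = 1 ∧
      ∀ s x, θ (groupRingToHahn Λ s * x) = f s * θ x := by
  have hker : (RingHom.ker f).IsPrime := RingHom.ker_isPrime f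
  obtain ⟨P, hP, hcomap⟩ := exists_prime_comap_eq (RingHom.ker f) hf
  let D := AddMonoidAlgebra ℤ Λ ⧸ RingHom.ker f
  let k := FractionRing D
  let E := FractionRing (HahnSeries Λ ℤ ⧸ P)
  let j : D →+* HahnSeries Λ ℤ ⧸ P :=
    Ideal.quotientMap P (groupRingToHahn Λ).toRingHom hcomap.ge
  have hj : Function.Injective j := Ideal.quotientMap_injective' hcomap.le
  let jE : k →+* E := IsFractionRing.lift (A := D)
    (g := (algebraMap (HahnSeries Λ ℤ ⧸ P) E).comp j)
    ((IsFractionRing.injective (HahnSeries Λ ℤ ⧸ P) E).comp hj)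
  let jK : k →+* K := IsFractionRing.lift (A := D) (g := RingHom.kerLift f)
    (RingHom.kerLift_injective f)
  -- Linearity over `k` is all that is needed; there need not be a ring homomorphism from `E` to
  -- `K`.
  obtain ⟨l, hl1, hl⟩ := exists_retraction jE
  let toE : HahnSeries Λ ℤ →+* E :=
    (algebraMap (HahnSeries Λ ℤ ⧸ P) E).comp (Ideal.Quotient.mk P)
  refine ⟨jK.toAddMonoidHom.comp (l.comp toE.toAddMonoidHom), ?_, fun s x => ?_⟩
  · change jK (l (toE 1)) = 1
    rw [map_one, hl1, map_one]
  · change jK (l (toE _)) = f s * jK (l (toE x))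
    have h1 : toE (groupRingToHahn Λ s) = jE (algebraMap D k (Ideal.Quotient.mk _ s)) := by
      rw [IsFractionRing.lift_algebraMap]; rfl
    have h2 : jK (algebraMap D k (Ideal.Quotient.mk _ s)) = f s := by
      rw [IsFractionRing.lift_algebraMap]; rfl
    rw [map_mul, h1, hl, map_mul, h2]

end Krull

/-- Choose a value at one representative of each orbit and transport it; freeness makes the
transporting element unique. -/
theorem exists_equivariant_choice {G S Y : Type*} [Group G] [MulAction G S]
    (hfree : ∀ (g h : G) (s : S), g • s = h • s → g = h) (L : G → Y → Y)
    (hL : ∀ g h y, L (g * h) y = L g (L h y)) (P : S → Y → Prop)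
    (hex : ∀ s, ∃ y, P s y) (hP : ∀ g s y, P s y → P (g • s) (L g y)) :
    ∃ f : S → Y, (∀ s, P s (f s)) ∧ ∀ g s, f (g • s) = L g (f s) := by
  let rep : S → S := fun s => (Quotient.mk (MulAction.orbitRel G S) s).out
  have hrep : ∀ s, ∃ g : G, g • rep s = s := fun s =>
    (MulAction.orbitRel_apply.1 ((MulAction.orbitRel G S).symm
      (Quotient.mk_out (s := MulAction.orbitRel G S) s)))
  choose t ht using hrep
  choose y hy using hex
  have hrep_smul : ∀ (g : G) s, rep (g • s) = rep s := fun g s =>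
    congrArg Quotient.out (Quotient.sound (s := MulAction.orbitRel G S) ⟨g, rfl⟩)
  refine ⟨fun s => L (t s) (y (rep s)), fun s => ?_, fun g s => ?_⟩
  · have := hP (t s) _ _ (hy (rep s))
    rwa [ht] at this
  · have : t (g • s) = g * t s := hfree _ _ (rep s) (by
      rw [mul_smul, ht, ← hrep_smul g s, ht])
    dsimp only
    rw [hrep_smul, this, hL]

/-! ### From vanishing over a bimodule to vanishing over a rank one module. -/

section Transfer

variable {X : Type*} [TopologicalSpace X] {x₀ : X}

theorem trans_right_cancel {x y z : X} {p q : Path.Homotopic.Quotient x y}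
    (r : Path.Homotopic.Quotient y z) (h : p.trans r = q.trans r) : p = q := by
  have h' := congrArg (fun s => Path.Homotopic.Quotient.trans s r.symm) h
  simpa [Path.Homotopic.Quotient.trans_assoc] using h'

theorem coverSimplex_smul_injective (n : ℕ) (g h : Pi1 X x₀) (σ : CoverSimplex X x₀ n)
    (hgh : g • σ = h • σ) : g = h := by
  obtain ⟨t⟩ : Nonempty (stdSimplex ℝ (Fin (n + 1))) := inferInstance
  -- The type of `lift t` depends on `proj`, hence the heterogeneous equality; it becomes an
  -- equality since both translates have the projection of `σ`.
  have h1 : ∀ τ τ' : CoverSimplex X x₀ n, τ = τ' → HEq (τ.lift t) (τ'.lift t) := by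
    rintro τ _ rfl; rfl
  have h2 := eq_of_heq (h1 (g • σ) (h • σ) hgh)
  have h3 := trans_right_cancel _ h2
  exact MulOpposite.unop_injective h3

theorem coverAct_single (n : ℕ) (g : Pi1 X x₀) (σ : CoverSimplex X x₀ n) (m : ℤ) :
    coverAct X x₀ n g (Finsupp.single σ m) = Finsupp.single (g • σ) m := by
  simp [coverAct, Finsupp.mapDomain_single]

section CoeffMap

variable {S A S' A' : Type*} [CommRing S] [AddCommGroup A] [Module S A]
  [CommRing S'] [AddCommGroup A'] [Module S' A']

/-- The class of `a ⊗ c` in the twisted chain module. -/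
def chainMk (r : Representation S (Pi1 X x₀)ᵐᵒᵖ A) (n : ℕ) (a : A) :
    CoverChain X x₀ n →ₗ[ℤ] TwistedChain X x₀ r n :=
  ((balancedRelations X x₀ r n).mkQ.restrictScalars ℤ).comp (TensorProduct.mk ℤ A _ a)

theorem chainMk_act (r : Representation S (Pi1 X x₀)ᵐᵒᵖ A) (n : ℕ) (a : A) (g : Pi1 X x₀)
    (c : CoverChain X x₀ n) :
    chainMk r n a (coverAct X x₀ n g c) = chainMk r n (r (MulOpposite.op g) a) c := by
  symm
  exact (Submodule.Quotient.eq _).2 (Submodule.subset_span ⟨a, g, c, rfl⟩)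

theorem twistedBoundary_chainMk (r : Representation S (Pi1 X x₀)ᵐᵒᵖ A) (n : ℕ) (a : A)
    (c : CoverChain X x₀ (n + 1)) :
    twistedBoundary X x₀ r n (chainMk r (n + 1) a c) =
      chainMk r n a (coverBoundary X x₀ n c) := rfl

theorem TwistedChain.induction {r : Representation S (Pi1 X x₀)ᵐᵒᵖ A} {n : ℕ}
    {P : TwistedChain X x₀ r n → Prop} (h0 : P 0) (hmk : ∀ a c, P (chainMk r n a c))
    (hadd : ∀ y z, P y → P z → P (y + z)) (y : TwistedChain X x₀ r n) : P y := by
  obtain ⟨y, rfl⟩ := Submodule.Quotient.mk_surjective _ y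
  induction y using TensorProduct.induction_on with
  | zero => exact h0
  | tmul a c => exact hmk a c
  | add y z hy hz => exact hadd _ _ hy hz

variable (r : Representation ℤ (Pi1 X x₀)ᵐᵒᵖ A) (r' : Representation S' (Pi1 X x₀)ᵐᵒᵖ A')

/-- The map of chain modules that is induced by an equivariant map of coefficients. -/
def coeffMap (φ : A →ₗ[ℤ] A')
    (hφ : ∀ g a, φ (r (MulOpposite.op g) a) = r' (MulOpposite.op g) (φ a)) (n : ℕ) :
    TwistedChain X x₀ r n →ₗ[ℤ] TwistedChain X x₀ r' n :=
  Submodule.liftQ _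
    (((balancedRelations X x₀ r' n).mkQ.restrictScalars ℤ).comp (TensorProduct.map φ LinearMap.id))
    (Submodule.span_le.2 (by
      rintro _ ⟨a, g, c, rfl⟩
      refine (Submodule.Quotient.mk_eq_zero _).2 (Submodule.subset_span ⟨φ a, g, c, ?_⟩)
      refine (map_sub (TensorProduct.map φ LinearMap.id) _ _).trans ?_
      rw [TensorProduct.map_tmul, TensorProduct.map_tmul, hφ]
      rfl))

variable {r r'}

theorem coeffMap_chainMk (φ : A →ₗ[ℤ] A')
    (hφ : ∀ g a, φ (r (MulOpposite.op g) a) = r' (MulOpposite.op g) (φ a)) (n : ℕ) (a : A)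
    (c : CoverChain X x₀ n) :
    coeffMap r r' φ hφ n (chainMk r n a c) = chainMk r' n (φ a) c := rfl

theorem twistedBoundary_coeffMap (φ : A →ₗ[ℤ] A')
    (hφ : ∀ g a, φ (r (MulOpposite.op g) a) = r' (MulOpposite.op g) (φ a)) (n : ℕ)
    (y : TwistedChain X x₀ r (n + 1)) :
    twistedBoundary X x₀ r' n (coeffMap r r' φ hφ (n + 1) y) =
      coeffMap r r' φ hφ n (twistedBoundary X x₀ r n y) := by
  induction y using TwistedChain.induction with
  | h0 => simp only [map_zero]
  | hmk a c => rfl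
  | hadd y z hy hz => simp only [map_add, hy, hz]

end CoeffMap

theorem mem_twistedBoundaries_of_subsingleton {S A : Type*} [CommRing S] [AddCommGroup A]
    [Module S A] {r : Representation S (Pi1 X x₀)ᵐᵒᵖ A} {n : ℕ}
    (h : Subsingleton (TwistedHomology X x₀ r n)) {z : TwistedChain X x₀ r n}
    (hz : z ∈ twistedCycles X x₀ r n) : ∃ y, twistedBoundary X x₀ r n y = z := by
  have h1 := Submodule.Quotient.subsingleton_iff.1 h
  have h2 : (⟨z, hz⟩ : twistedCycles X x₀ r n) ∈
    (twistedBoundaries X x₀ r n).submoduleOf (twistedCycles X x₀ r n) := h1 ▸ trivial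
  exact h2

variable {K : Type*} [Field K] (ρ : Pi1 X x₀ →* Kˣ)

/-- The `K`-linear extension to `K ⊗ C_n` of a map defined on `C_n`. -/
def scalarLift {n m : ℕ} (F : CoverChain X x₀ n →ₗ[ℤ] TwistedChain X x₀ (charModule ρ) m) :
    K ⊗[ℤ] CoverChain X x₀ n →ₗ[K] TwistedChain X x₀ (charModule ρ) m :=
  TensorProduct.AlgebraTensorModule.lift (LinearMap.toSpanSingleton K _ F)

variable {ρ}

theorem scalarLift_tmul {n m : ℕ}
    (F : CoverChain X x₀ n →ₗ[ℤ] TwistedChain X x₀ (charModule ρ) m) (a : K)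
    (c : CoverChain X x₀ n) : scalarLift ρ F (a ⊗ₜ c) = a • F c := rfl

theorem scalarLift_eq_zero {n m : ℕ}
    {F : CoverChain X x₀ n →ₗ[ℤ] TwistedChain X x₀ (charModule ρ) m}
    (hF : ∀ g c, F (coverAct X x₀ n g c) = (ρ g : K) • F c) {z : K ⊗[ℤ] CoverChain X x₀ n}
    (hz : z ∈ balancedRelations X x₀ (charModule ρ) n) : scalarLift ρ F z = 0 := by
  refine (Submodule.span_le.2 ?_ : _ ≤ LinearMap.ker (scalarLift ρ F)) hz
  rintro _ ⟨a, g, c, rfl⟩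
  rw [SetLike.mem_coe, LinearMap.mem_ker, map_sub, scalarLift_tmul, scalarLift_tmul, hF, smul_smul,
    sub_eq_zero]
  congr 1
  exact mul_comm _ _

theorem chainMk_charModule (n : ℕ) (a : K) (c : CoverChain X x₀ n) :
    chainMk (charModule ρ) n a c = a • chainMk (charModule ρ) n 1 c := by
  change Submodule.Quotient.mk _ = a • Submodule.Quotient.mk _
  rw [← Submodule.Quotient.mk_smul]
  change Submodule.Quotient.mk (a ⊗ₜ c) = Submodule.Quotient.mk (a • ((1 : K) ⊗ₜ[ℤ] c))
  rw [TensorProduct.smul_tmul', smul_eq_mul, mul_one]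

/-- If the homology of `X` with coefficients in a bimodule `A` with a central element `e` vanishes
up to degree `q`, then so does the homology with coefficients in every rank one module `K_ρ` that
receives a bimodule map from `A` which sends `e` to `1`. The chain modules are free over the group
ring, possibly of infinite rank, so no finiteness condition on `X` is needed. -/
theorem subsingleton_homology_of_linear_map {A : Type*} [AddCommGroup A]
    (r : Representation ℤ (Pi1 X x₀)ᵐᵒᵖ A) (l : Representation ℤ (Pi1 X x₀) A)
    (hlr : ∀ g h a, l h (r (MulOpposite.op g) a) = r (MulOpposite.op g) (l h a))
    (e : A) (he : ∀ g, l g e = r (MulOpposite.op g) e)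
    (θ : A →ₗ[ℤ] K) (hθe : θ e = 1) (hθl : ∀ g a, θ (l g a) = ρ g * θ a)
    (hθr : ∀ g a, θ (r (MulOpposite.op g) a) = ρ g * θ a) (q : ℕ)
    (hq : ∀ i ≤ q, Subsingleton (TwistedHomology X x₀ r i)) (i : ℕ) (hi : i ≤ q) :
    Subsingleton (TwistedHomology X x₀ (charModule ρ) i) := by
  have hθr' : ∀ g a, θ (r (MulOpposite.op g) a) =
      charModule ρ (MulOpposite.op g) (θ a) := hθr
  -- The left action on `A` commutes with the right one, so it survives on A ⊗ C.
  let L : ∀ (n : ℕ) (g : Pi1 X x₀), TwistedChain X x₀ r n →ₗ[ℤ] TwistedChain X x₀ r n :=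
    fun n g => coeffMap r r (l g) (fun h a => hlr h g a) n
  let T : ∀ n : ℕ, TwistedChain X x₀ r n →ₗ[ℤ] TwistedChain X x₀ (charModule ρ) n :=
    fun n => coeffMap r (charModule ρ) θ hθr' n
  have hLmul : ∀ n g h y, L n (g * h) y = L n g (L n h y) := by
    intro n g h y
    induction y using TwistedChain.induction with
    | h0 => simp only [map_zero]
    | hmk a c => simp only [L, coeffMap_chainMk, map_mul, Module.End.mul_apply]
    | hadd y z hy hz => simp only [map_add, hy, hz]
  have hTL : ∀ n g y, T n (L n g y) = (ρ g : K) • T n y := by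
    intro n g y
    induction y using TwistedChain.induction with
    | h0 => simp only [map_zero, smul_zero]
    | hmk a c =>
      simp only [T, L, coeffMap_chainMk]
      rw [hθl, chainMk_charModule, chainMk_charModule (a := θ a), smul_smul]
    | hadd y z hy hz => simp only [map_add, hy, hz, smul_add]
  -- Equivariant lifting through the boundary map, as the singular simplices form free orbits.
  have hlift : ∀ n, ∀ k : CoverChain X x₀ n →ₗ[ℤ] TwistedChain X x₀ r n,
      (∀ g c, k (coverAct X x₀ n g c) = L n g (k c)) →
      (∀ c, k c ∈ twistedCycles X x₀ r n) →
      Subsingleton (TwistedHomology X x₀ r n) →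
      ∃ h : CoverChain X x₀ n →ₗ[ℤ] TwistedChain X x₀ r (n + 1),
        (∀ g c, h (coverAct X x₀ n g c) = L (n + 1) g (h c)) ∧
        ∀ c, twistedBoundary X x₀ r n (h c) = k c := by
    intro n k hk hkc hH
    obtain ⟨f, hf, hfg⟩ := exists_equivariant_choice (coverSimplex_smul_injective n)
      (fun g y => L (n + 1) g y) (hLmul (n + 1))
      (fun σ y => twistedBoundary X x₀ r n y = k (Finsupp.single σ 1))
      (fun σ => mem_twistedBoundaries_of_subsingleton hH (hkc _))
      (fun g σ y hy => by
        rw [twistedBoundary_coeffMap, hy, ← coverAct_single, hk])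
    refine ⟨Finsupp.linearCombination ℤ f, fun g c => ?_, fun c => ?_⟩
    · induction c using Finsupp.induction_linear with
      | zero => simp only [map_zero]
      | add c d hc hd => simp only [map_add, hc, hd]
      | single σ a =>
        rw [coverAct_single, Finsupp.linearCombination_single, Finsupp.linearCombination_single,
          hfg, map_smul]
    · induction c using Finsupp.induction_linear with
      | zero => simp only [map_zero]
      | add c d hc hd => simp only [map_add, hc, hd]
      | single σ a =>
        rw [Finsupp.linearCombination_single, map_zsmul, hf, ← map_smul, Finsupp.smul_single,
          smul_eq_mul, mul_one]
  have hι : ∀ n g c, chainMk r n e (coverAct X x₀ n g c) = L n g (chainMk r n e c) := by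
    intro n g c
    rw [chainMk_act, ← he]
    rfl
  have hliftι : ∀ n (z : K ⊗[ℤ] CoverChain X x₀ n),
      scalarLift ρ ((T n).comp (chainMk r n e)) z = Submodule.Quotient.mk z := by
    intro n z
    induction z using TensorProduct.induction_on with
    | zero => simp only [map_zero, Submodule.Quotient.mk_zero]
    | tmul a c =>
      rw [scalarLift_tmul, LinearMap.comp_apply]
      simp only [T, coeffMap_chainMk]
      rw [hθe, ← chainMk_charModule]
      rfl
    | add y z hy hz => rw [map_add, hy, hz, Submodule.Quotient.mk_add]
  -- Here k₀ = ι and k_{n+1} = ι − h_n∂, where ι(c) = e ⊗ c and ∂h_n = k_n. Agreement with ι on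
  -- boundaries makes the next `k` cycle-valued; the last clause says that the correction h_n∂
  -- disappears on twisted cycles after applying θ.
  have main : ∀ n ≤ q, ∃ k : CoverChain X x₀ n →ₗ[ℤ] TwistedChain X x₀ r n,
      (∀ g c, k (coverAct X x₀ n g c) = L n g (k c)) ∧
      (∀ c, k c ∈ twistedCycles X x₀ r n) ∧
      (∀ c, k (coverBoundary X x₀ n c) = chainMk r n e (coverBoundary X x₀ n c)) ∧
      ∀ z : K ⊗[ℤ] CoverChain X x₀ n,
        Submodule.Quotient.mk z ∈ twistedCycles X x₀ (charModule ρ) n →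
        scalarLift ρ ((T n).comp k) z = Submodule.Quotient.mk z := by
    intro n
    induction n with
    | zero =>
      exact fun _ => ⟨chainMk r 0 e, hι 0, fun _ => trivial, fun _ => rfl, fun z _ => hliftι 0 z⟩
    | succ n ih =>
      intro hn
      obtain ⟨k, hk, hkc, hkb, -⟩ := ih (by omega)
      obtain ⟨h, hh, hb⟩ := hlift n k hk hkc (hq n (by omega))
      refine ⟨chainMk r (n + 1) e - h.comp (coverBoundary X x₀ n), fun g c => ?_, fun c => ?_,
        fun c => ?_, fun z hz => ?_⟩
      · simp only [LinearMap.sub_apply, LinearMap.comp_apply, hι, coverBoundary_act, hh, map_sub]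
      · change twistedBoundary X x₀ r n _ = 0
        rw [LinearMap.sub_apply, LinearMap.comp_apply, map_sub, twistedBoundary_chainMk, hb, hkb,
          sub_self]
      · rw [LinearMap.sub_apply, LinearMap.comp_apply, coverBoundary_coverBoundary, map_zero,
          sub_zero]
      · have h1 : ∀ z : K ⊗[ℤ] CoverChain X x₀ (n + 1),
            scalarLift ρ ((T (n + 1)).comp
              (chainMk r (n + 1) e - h.comp (coverBoundary X x₀ n))) z =
            Submodule.Quotient.mk z - scalarLift ρ ((T (n + 1)).comp h)
              (TensorProduct.AlgebraTensorModule.lTensor K K (coverBoundary X x₀ n) z) := by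
          intro z
          rw [← hliftι]
          induction z using TensorProduct.induction_on with
          | zero => simp only [map_zero, sub_zero]
          | tmul a c =>
            simp only [scalarLift_tmul, TensorProduct.AlgebraTensorModule.lTensor_tmul,
              LinearMap.comp_apply, LinearMap.sub_apply, map_sub, smul_sub]
          | add y z hy hz =>
            simp only [map_add, hy, hz]
            abel
        -- For a twisted cycle, the boundary of `z` lies in the balanced relations, which the
        -- equivariant map built from `h` kills.
        rw [h1, scalarLift_eq_zero, sub_zero]
        · intro g c
          rw [LinearMap.comp_apply, hh, hTL]
          rfl
        · exact (Submodule.Quotient.mk_eq_zero _).1 hz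
  obtain ⟨k, hk, hkc, -, hfix⟩ := main i hi
  obtain ⟨h, hh, hb⟩ := hlift i k hk hkc (hq i hi)
  refine Submodule.Quotient.subsingleton_iff.2 (Submodule.eq_top_iff'.2 ?_)
  rintro ⟨z, hz⟩
  change z ∈ twistedBoundaries X x₀ (charModule ρ) i
  obtain ⟨z, rfl⟩ := Submodule.Quotient.mk_surjective _ z
  refine ⟨scalarLift ρ ((T (i + 1)).comp h) z, ?_⟩
  rw [← hfix z hz]
  clear hz
  induction z using TensorProduct.induction_on with
  | zero => simp only [map_zero]
  | tmul a c =>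
    rw [scalarLift_tmul, scalarLift_tmul, map_smul, LinearMap.comp_apply, LinearMap.comp_apply,
      twistedBoundary_coeffMap, hb]
  | add y z hy hz => rw [map_add, map_add, map_add, hy, hz]

end Transfer

/-! ### The Novikov–Sikorav completion as a bimodule. -/

section NovikovBimodule

variable {G : Type*} [Group G] (χ : Additive G →+ ℝ)

/-- The Novikov-Sikorav completion as a left module over the group ring. -/
def novikovLeftModule : Representation ℤ G (novikovCompletion χ) where
  toFun h :=
    { toFun := fun f => ⟨fun g => f.1 (h⁻¹ * g), by
        intro c
        refine ((f.2 (c - χ (Additive.ofMul h))).image (h * ·)).subset ?_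
        rintro g ⟨hg, hc⟩
        refine ⟨h⁻¹ * g, ⟨hg, ?_⟩, by simp⟩
        rw [ofMul_mul, ofMul_inv, map_add, map_neg]
        linarith⟩
      map_add' := fun _ _ => rfl
      map_smul' := fun _ _ => rfl }
  map_one' := by
    refine LinearMap.ext fun f => Subtype.ext <| funext fun g => ?_
    simp
  map_mul' h h' := by
    refine LinearMap.ext fun f => Subtype.ext <| funext fun g => ?_
    simp [mul_assoc]

open Classical in
/-- The unit of the Novikov-Sikorav completion. -/
def novikovOne : novikovCompletion χ :=
  ⟨Pi.single 1 1, fun c => (Set.finite_singleton (1 : G)).subset fun g hg => by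
    by_contra h
    exact hg.1 (Pi.single_eq_of_ne h 1)⟩

theorem novikovLeftModule_one (g : G) :
    novikovLeftModule χ g (novikovOne χ) = novikovModule χ (MulOpposite.op g) (novikovOne χ) := by
  classical
  refine Subtype.ext (funext fun h => ?_)
  change (Pi.single 1 1 : G → ℤ) (g⁻¹ * h) = (Pi.single 1 1 : G → ℤ) (h * g⁻¹)
  simp only [Pi.single_apply, inv_mul_eq_one, mul_inv_eq_one, eq_comm]

theorem novikovLeftModule_comm (g h : G) (f : novikovCompletion χ) :
    novikovLeftModule χ h (novikovModule χ (MulOpposite.op g) f) =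
      novikovModule χ (MulOpposite.op g) (novikovLeftModule χ h f) :=
  Subtype.ext (funext fun _ => congrArg f.1 (mul_assoc _ _ _))

variable {χ}

theorem novikovModule_apply (h : G) (f : novikovCompletion χ) (g : G) :
    (novikovModule χ (MulOpposite.op h) f).1 g = f.1 (g * h⁻¹) := rfl

theorem novikovLeftModule_apply (h : G) (f : novikovCompletion χ) (g : G) :
    (novikovLeftModule χ h f).1 g = f.1 (h⁻¹ * g) := rfl

end NovikovBimodule

theorem notMem_iUnion_charVariety {X : Type*} [TopologicalSpace X] {x₀ : X} {K : Type*} [Field K]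
    {ρ : Pi1 X x₀ →* Kˣ} {χ : Additive (Pi1 X x₀) →+ ℝ} {q : ℕ}
    (hq : ∀ i ≤ q, Subsingleton (TwistedHomology X x₀ (novikovModule χ) i))
    (θ : novikovCompletion χ →+ K) (hθ : θ (novikovOne χ) = 1)
    (hθl : ∀ g a, θ (novikovLeftModule χ g a) = ρ g * θ a)
    (hθr : ∀ g a, θ (novikovModule χ (MulOpposite.op g) a) = ρ g * θ a) :
    ρ ∉ ⋃ i ≤ q, charVariety X x₀ K i 1 := by
  intro h
  simp only [Set.mem_iUnion] at h
  obtain ⟨i, hi, hρ⟩ := h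
  have hs := subsingleton_homology_of_linear_map (novikovModule χ) (novikovLeftModule χ)
    (fun g h a => novikovLeftModule_comm χ g h a) (novikovOne χ) (novikovLeftModule_one χ)
    { toFun := θ, map_add' := map_add θ, map_smul' := fun n f => map_zsmul θ n f }
    hθ hθl hθr q hq i hi
  have h1 : ((1 : ℕ) : Cardinal) ≤
    Module.rank K (TwistedHomology X x₀ (charModule ρ) i) := hρ
  rw [rank_subsingleton', Nat.cast_one] at h1
  exact absurd h1 (not_le.2 zero_lt_one)

/-! ### Evaluation at a character by a generalized limit. -/

section Valuation

variable {G K : Type*} [Group G] [Field K] (v : AddValuation K (WithTop ℝ)) (ρ : G →* Kˣ)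

theorem coe_valuationComp (g : G) :
    ((valuationComp v ρ (Additive.ofMul g) : ℝ) : WithTop ℝ) = v (ρ g : K) :=
  WithTop.coe_untop _ _

/-- The elements of valuation at least `c`. -/
def valuationBall (c : ℝ) : AddSubgroup K where
  carrier := {x | (c : WithTop ℝ) ≤ v x}
  zero_mem' := by simp
  add_mem' {x y} hx hy := (le_min hx hy).trans (v.map_add x y)
  neg_mem' {x} hx := by simpa using hx

/-- The functions `ℝ → K` that tend to zero at infinity for the given valuation. -/
def nullFunctions : Submodule K (ℝ → K) where
  carrier := {u | ∀ c : ℝ, ∃ T : ℝ, ∀ t ≥ T, u t ∈ valuationBall v c}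
  zero_mem' c := ⟨0, fun _ _ => zero_mem _⟩
  add_mem' {u w} hu hw c := by
    obtain ⟨T, hT⟩ := hu c
    obtain ⟨T', hT'⟩ := hw c
    exact ⟨max T T', fun t ht => add_mem (hT t ((le_max_left _ _).trans ht))
      (hT' t ((le_max_right _ _).trans ht))⟩
  smul_mem' a u hu c := by
    by_cases ha : a = 0
    · exact ⟨0, fun t _ => by simp [ha, zero_mem]⟩
    obtain ⟨r, hr⟩ := WithTop.ne_top_iff_exists.1 (v.ne_top_iff.2 ha)
    obtain ⟨T, hT⟩ := hu (c - r)
    refine ⟨T, fun t ht => ?_⟩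
    change (c : WithTop ℝ) ≤ v (a * u t)
    rw [v.map_mul, ← hr]
    have h1 : ((c - r : ℝ) : WithTop ℝ) ≤ v (u t) := hT t ht
    calc (c : WithTop ℝ) = (r : WithTop ℝ) + ((c - r : ℝ) : WithTop ℝ) := by
          rw [← WithTop.coe_add]; congr 1; ring
      _ ≤ _ := by gcongr

/-- The constant 1 is not null since v(1) = 0, so some functional kills the null functions but not
1. -/
theorem exists_generalized_limit : ∃ l : (ℝ → K) →ₗ[K] K, l 1 = 1 ∧
    ∀ u ∈ nullFunctions v, l u = 0 := by
  have h1 : (1 : ℝ → K) ∉ nullFunctions v := fun h => by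
    obtain ⟨T, hT⟩ := h 1
    have h2 : ((1 : ℝ) : WithTop ℝ) ≤ v (1 : K) := hT T le_rfl
    rw [v.map_one, ← WithTop.coe_zero, WithTop.coe_le_coe] at h2
    exact absurd h2 (not_le.2 zero_lt_one)
  obtain ⟨l, hl, hker⟩ := Submodule.exists_le_ker_of_notMem h1
  refine ⟨(l 1)⁻¹ • l, ?_, fun u hu => ?_⟩
  · rw [LinearMap.smul_apply, smul_eq_mul, inv_mul_cancel₀ hl]
  · rw [LinearMap.smul_apply, LinearMap.mem_ker.1 (hker hu), smul_zero]

open Classical in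
/-- The sum of the terms of character at most `t` in the image of a formal sum under `ρ`. -/
def partialSum (f : novikovCompletion (-valuationComp v ρ)) (t : ℝ) : K :=
  ∑ᶠ g : G, if valuationComp v ρ (Additive.ofMul g) ≤ t then f.1 g • (ρ g : K) else 0

open Classical in
theorem finite_support_partialSum (f : novikovCompletion (-valuationComp v ρ)) (t : ℝ) :
    (Function.support fun g : G =>
      if valuationComp v ρ (Additive.ofMul g) ≤ t then f.1 g • (ρ g : K) else 0).Finite := by
  refine (f.2 (-t)).subset fun g hg => ?_
  rw [Function.mem_support] at hg
  split_ifs at hg with h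
  · refine ⟨fun h0 => hg (by rw [h0, zero_smul]), ?_⟩
    rw [AddMonoidHom.neg_apply]
    exact neg_le_neg h
  · exact absurd rfl hg

theorem partialSum_add (f f' : novikovCompletion (-valuationComp v ρ)) (t : ℝ) :
    partialSum v ρ (f + f') t = partialSum v ρ f t + partialSum v ρ f' t := by
  classical
  rw [partialSum, partialSum, partialSum, ← finsum_add_distrib
    (finite_support_partialSum v ρ f t) (finite_support_partialSum v ρ f' t)]
  refine finsum_congr fun g => ?_
  split_ifs with h
  · exact add_smul _ _ _
  · rw [add_zero]

theorem partialSum_one {t : ℝ} (ht : 0 ≤ t) :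
    partialSum v ρ (novikovOne (-valuationComp v ρ)) t = 1 := by
  classical
  rw [partialSum, finsum_eq_single _ 1]
  · rw [if_pos (by rwa [ofMul_one, map_zero])]
    simp [novikovOne]
  · intro g hg
    simp [novikovOne, Pi.single_eq_of_ne hg]

/-- Reindexing by right translation scales each term by `ρ h` and moves the cutoff by its valuation.
-/
theorem partialSum_right (h : G) (f : novikovCompletion (-valuationComp v ρ)) (t : ℝ) :
    partialSum v ρ (novikovModule _ (MulOpposite.op h) f) t =
      ρ h * partialSum v ρ f (t - valuationComp v ρ (Additive.ofMul h)) := by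
  classical
  rw [partialSum, partialSum, mul_finsum,
    ← finsum_comp_equiv (Equiv.mulRight h)]
  refine finsum_congr fun g => ?_
  rw [novikovModule_apply, Equiv.coe_mulRight, mul_inv_cancel_right, ofMul_mul, map_add, map_mul,
    Units.val_mul]
  rw [mul_comm (ρ g : K)]
  simp only [le_sub_iff_add_le, mul_ite, mul_zero, mul_smul_comm]

theorem partialSum_left (h : G) (f : novikovCompletion (-valuationComp v ρ)) (t : ℝ) :
    partialSum v ρ (novikovLeftModule _ h f) t =
      ρ h * partialSum v ρ f (t - valuationComp v ρ (Additive.ofMul h)) := by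
  classical
  rw [partialSum, partialSum, mul_finsum,
    ← finsum_comp_equiv (Equiv.mulLeft h)]
  refine finsum_congr fun g => ?_
  rw [novikovLeftModule_apply, Equiv.coe_mulLeft, inv_mul_cancel_left, ofMul_mul, map_add, map_mul,
    Units.val_mul]
  simp only [le_sub_iff_add_le, mul_ite, mul_zero, mul_smul_comm, add_comm]

/-- The Cauchy property: terms of value at most `c` occur in both sums and cancel, and integer
multiples do not lower the valuation of the others. -/
theorem partialSum_sub_mem (f : novikovCompletion (-valuationComp v ρ)) {c t t' : ℝ}
    (ht : c ≤ t) (ht' : c ≤ t') :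
    partialSum v ρ f t - partialSum v ρ f t' ∈ valuationBall v c := by
  classical
  rw [partialSum, partialSum, ← finsum_sub_distrib
    (finite_support_partialSum v ρ f t) (finite_support_partialSum v ρ f t')]
  refine finsum_induction (· ∈ valuationBall v c) (zero_mem _) (fun _ _ => add_mem) fun g => ?_
  by_cases hg : valuationComp v ρ (Additive.ofMul g) ≤ c
  · rw [if_pos (hg.trans ht), if_pos (hg.trans ht'), sub_self]
    exact zero_mem _
  · have h1 : (ρ g : K) ∈ valuationBall v c := by
      change (c : WithTop ℝ) ≤ v (ρ g : K)
      rw [← coe_valuationComp, WithTop.coe_le_coe]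
      exact (not_le.1 hg).le
    refine sub_mem ?_ ?_ <;> split_ifs
    exacts [zsmul_mem h1 _, zero_mem _, zsmul_mem h1 _, zero_mem _]

theorem partialSum_shift_mem (f : novikovCompletion (-valuationComp v ρ)) (s : ℝ) :
    (fun t => partialSum v ρ f (t - s) - partialSum v ρ f t) ∈ nullFunctions v := fun c =>
  ⟨max c (c + s), fun t ht => partialSum_sub_mem v ρ f
    (by linarith [(le_max_right c (c + s)).trans ht]) ((le_max_left _ _).trans ht)⟩

/-- Evaluation of formal sums at `ρ`, by means of a generalized limit. -/
theorem exists_valuation_extension :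
    ∃ θ : novikovCompletion (-valuationComp v ρ) →+ K, θ (novikovOne _) = 1 ∧
      (∀ g a, θ (novikovLeftModule _ g a) = ρ g * θ a) ∧
      ∀ g a, θ (novikovModule _ (MulOpposite.op g) a) = ρ g * θ a := by
  obtain ⟨l, hl1, hl⟩ := exists_generalized_limit v
  have hshift : ∀ (g : G) f, l (fun t => (ρ g : K) *
      partialSum v ρ f (t - valuationComp v ρ (Additive.ofMul g))) =
      ρ g * l (partialSum v ρ f) := by
    intro g f
    have h1 := hl _ (partialSum_shift_mem v ρ f (valuationComp v ρ (Additive.ofMul g)))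
    have h2 : l ((fun t => partialSum v ρ f (t - valuationComp v ρ (Additive.ofMul g))) -
      partialSum v ρ f) = 0 := h1
    rw [map_sub, sub_eq_zero] at h2
    rw [← h2, ← smul_eq_mul, ← map_smul]
    rfl
  refine ⟨{ toFun := fun f => l (partialSum v ρ f), map_zero' := ?_, map_add' := ?_ },
    ?_, fun g f => ?_, fun g f => ?_⟩
  · have : partialSum v ρ 0 = 0 := funext fun t => by simp [partialSum]
    rw [this, map_zero]
  · intro f f'
    rw [← map_add]
    exact congrArg l (funext fun t => partialSum_add v ρ f f' t)
  · change l (partialSum v ρ (novikovOne _)) = 1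
    have h1 : partialSum v ρ (novikovOne _) - 1 ∈ nullFunctions v := fun c =>
      ⟨0, fun t ht => by
        rw [Pi.sub_apply, partialSum_one v ρ ht, Pi.one_apply, sub_self]
        exact zero_mem _⟩
    have h2 := hl _ h1
    rwa [map_sub, hl1, sub_eq_zero] at h2
  · change l (partialSum v ρ _) = ρ g * l (partialSum v ρ f)
    rw [← hshift]
    exact congrArg l (funext fun t => partialSum_left v ρ g f t)
  · change l (partialSum v ρ _) = ρ g * l (partialSum v ρ f)
    rw [← hshift]
    exact congrArg l (funext fun t => partialSum_right v ρ g f t)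

end Valuation

/-! ### Evaluation at a character of the image of `χ` through Hahn series. -/

section AbelianCompletion

variable {G : Type*} [Group G] (χ : Additive G →+ ℝ)

theorem isPWO_of_finite_inter_Iic {α : Type*} [LinearOrder α] {s : Set α}
    (hs : ∀ a, (s ∩ Set.Iic a).Finite) : s.IsPWO := by
  refine Set.isPWO_iff_isWF.2 (Set.isWF_iff_no_descending_seq.2 fun u hu h => ?_)
  refine Set.infinite_range_of_injective hu.injective ((hs (u 0)).subset ?_)
  rintro _ ⟨n, rfl⟩
  exact ⟨h n, hu.antitone (Nat.zero_le n)⟩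

/-- The preimage in the Novikov-Sikorav completion of the powers up to `γ`. -/
theorem finite_fiber (f : novikovCompletion χ) (γ : χ.range) :
    {g : G | f.1 g ≠ 0 ∧ -χ.rangeRestrict (Additive.ofMul g) ≤ γ}.Finite := by
  refine (f.2 (-(γ : ℝ))).subset ?_
  rintro g ⟨hg, hle⟩
  refine ⟨hg, ?_⟩
  have h1 : -χ (Additive.ofMul g) ≤ (γ : ℝ) := hle
  linarith

open Classical in
theorem finite_support_fiber (f : novikovCompletion χ) (γ : χ.range) :
    (Function.support fun g : G =>
      if -χ.rangeRestrict (Additive.ofMul g) = γ then f.1 g else 0).Finite := by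
  refine (finite_fiber χ f γ).subset fun g hg => ?_
  rw [Function.mem_support] at hg
  split_ifs at hg with h
  · exact ⟨hg, h.le⟩
  · exact absurd rfl hg

open Classical in
/-- The image of a formal sum over `G` in the completed group ring of the image of `χ`; the value
of a character is encoded as minus the exponent of a Hahn series. -/
def novikovToHahn : novikovCompletion χ →+ HahnSeries χ.range ℤ where
  toFun f :=
    { coeff := fun γ => ∑ᶠ g : G, if -χ.rangeRestrict (Additive.ofMul g) = γ then f.1 g else 0
      isPWO_support' := by
        refine isPWO_of_finite_inter_Iic fun γ => ?_
        refine ((finite_fiber χ f γ).image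
          fun g => -χ.rangeRestrict (Additive.ofMul g)).subset ?_
        rintro δ ⟨hδ, hle⟩
        obtain ⟨g, hg⟩ := not_forall.1 fun h => hδ (finsum_eq_zero_of_forall_eq_zero h)
        split_ifs at hg with h
        · exact ⟨g, ⟨hg, h.le.trans hle⟩, h⟩
        · exact absurd rfl hg }
  map_zero' := by
    ext γ
    simp
  map_add' f f' := by
    ext γ
    rw [HahnSeries.coeff_add]
    change _ = finsum _ + finsum _
    rw [← finsum_add_distrib (finite_support_fiber χ f γ) (finite_support_fiber χ f' γ)]
    refine finsum_congr fun g => ?_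
    split_ifs
    · rfl
    · rw [add_zero]

variable {χ}

open Classical in
theorem novikovToHahn_coeff (f : novikovCompletion χ) (γ : χ.range) :
    (novikovToHahn χ f).coeff γ =
      ∑ᶠ g : G, if -χ.rangeRestrict (Additive.ofMul g) = γ then f.1 g else 0 := rfl

theorem novikovToHahn_one : novikovToHahn χ (novikovOne χ) = 1 := by
  classical
  ext γ
  rw [novikovToHahn_coeff, finsum_eq_single _ 1]
  · rw [HahnSeries.coeff_one, ofMul_one, map_zero, neg_zero]
    simp [novikovOne, eq_comm]
  · intro g hg
    simp [novikovOne, Pi.single_eq_of_ne hg]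

theorem novikovToHahn_right (h : G) (f : novikovCompletion χ) :
    novikovToHahn χ (novikovModule χ (MulOpposite.op h) f) =
      HahnSeries.single (-χ.rangeRestrict (Additive.ofMul h)) 1 * novikovToHahn χ f := by
  classical
  ext γ
  rw [HahnSeries.coeff_single_mul, one_mul, novikovToHahn_coeff, novikovToHahn_coeff,
    ← finsum_comp_equiv (Equiv.mulRight h)]
  refine finsum_congr fun g => ?_
  rw [novikovModule_apply, Equiv.coe_mulRight, mul_inv_cancel_right, ofMul_mul, map_add, neg_add]
  simp only [eq_sub_iff_add_eq]

theorem novikovToHahn_left (h : G) (f : novikovCompletion χ) :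
    novikovToHahn χ (novikovLeftModule χ h f) =
      HahnSeries.single (-χ.rangeRestrict (Additive.ofMul h)) 1 * novikovToHahn χ f := by
  classical
  ext γ
  rw [HahnSeries.coeff_single_mul, one_mul, novikovToHahn_coeff, novikovToHahn_coeff,
    ← finsum_comp_equiv (Equiv.mulLeft h)]
  refine finsum_congr fun g => ?_
  rw [novikovLeftModule_apply, Equiv.coe_mulLeft, inv_mul_cancel_left, ofMul_mul, map_add, neg_add]
  simp only [eq_sub_iff_add_eq']

/-- Evaluation of elements of the group ring at the inverse of a character. -/
def evalInv {Γ : AddSubgroup ℝ} {K : Type*} [Field K] (ρ : Multiplicative Γ →* Kˣ) :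
    AddMonoidAlgebra ℤ Γ →+* K :=
  (AddMonoidAlgebra.lift ℤ K Γ ((Units.coeHom K).comp ρ)).toRingHom.comp
    (AddMonoidAlgebra.mapDomainRingHom ℤ (negAddMonoidHom : Γ →+ Γ))

theorem evalInv_single {Γ : AddSubgroup ℝ} {K : Type*} [Field K] (ρ : Multiplicative Γ →* Kˣ)
    (γ : Γ) : evalInv ρ (AddMonoidAlgebra.single γ 1) = ρ (Multiplicative.ofAdd (-γ)) := by
  simp [evalInv]

/-- The leading term of a Hahn series has the least exponent, whereas algebraic integers refer to
the greatest one; the negation of exponents in `evalInv` reconciles the two. -/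
theorem lc_ne_one_of_evalInv_eq_zero {Γ : AddSubgroup ℝ} {K : Type*} [Field K]
    {ρ : Multiplicative Γ →* Kˣ} (hρ : ¬ IsAlgebraicInteger ρ) (s : AddMonoidAlgebra ℤ Γ)
    (hs : evalInv ρ s = 0) : lc s ≠ 1 := by
  intro hlc
  have hcoeff : ∀ γ, (AddMonoidAlgebra.mapDomainRingHom ℤ (negAddMonoidHom : Γ →+ Γ) s).coeff γ =
      s.coeff (-γ) := fun γ => by
    have := Finsupp.mapDomain_apply (f := fun γ : Γ => -γ) neg_injective s.coeff (-γ)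
    rwa [neg_neg] at this
  refine hρ ⟨AddMonoidAlgebra.mapDomainRingHom ℤ (negAddMonoidHom : Γ →+ Γ) s, -ord s,
    ⟨?_, fun γ hγ => ?_⟩, ?_, hs⟩
  · rw [Set.mem_ofPred_eq, hcoeff, neg_neg, coeff_ord, hlc]
    exact one_ne_zero
  · rw [Set.mem_ofPred_eq, hcoeff] at hγ
    by_contra! h
    exact hγ (coeff_eq_zero_of_lt_ord (neg_lt.1 h))
  · rw [hcoeff, neg_neg, coeff_ord, hlc]

theorem exists_abelian_extension {K : Type*} [Field K] {ρ : Multiplicative χ.range →* Kˣ}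
    (hρ : ¬ IsAlgebraicInteger ρ) :
    ∃ θ : novikovCompletion χ →+ K, θ (novikovOne _) = 1 ∧
      (∀ g a, θ (novikovLeftModule _ g a) = pullbackChar χ ρ g * θ a) ∧
      ∀ g a, θ (novikovModule _ (MulOpposite.op g) a) = pullbackChar χ ρ g * θ a := by
  obtain ⟨θ, hθ1, hθ⟩ := exists_linear_extension (evalInv ρ) (lc_ne_one_of_evalInv_eq_zero hρ)
  have key : ∀ (g : G) x, θ (HahnSeries.single (-χ.rangeRestrict (Additive.ofMul g)) 1 * x) =
      pullbackChar χ ρ g * θ x := by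
    intro g x
    -- The sign changes of `novikovToHahn` and `evalInv` cancel.
    rw [← groupRingToHahn_single, hθ, evalInv_single, neg_neg]
    rfl
  refine ⟨θ.comp (novikovToHahn χ), ?_, fun g f => ?_, fun g f => ?_⟩
  · rw [AddMonoidHom.comp_apply, novikovToHahn_one, hθ1]
  · rw [AddMonoidHom.comp_apply, novikovToHahn_left, key]; rfl
  · rw [AddMonoidHom.comp_apply, novikovToHahn_right, key]; rfl

end AbelianCompletion

end BNSR

end

theorem theorem1p2 {X : Type*} [TopologicalSpace X] [T2Space X] [ConnectedSpace X]
    [Topology.CWComplex (Set.univ : Set X)] (x₀ : X) (k : ℕ) (hk : 1 ≤ k)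
    (hfin : ∀ n ≤ k, Finite (Topology.RelCWComplex.cell (Set.univ : Set X) n))
    (K : Type*) [Field K] (q : ℕ) (hq : q ≤ k) :
    (∀ (ρ : BNSR.Pi1 X x₀ →* Kˣ) (v : AddValuation K (WithTop ℝ)),
      ρ ∈ ⋃ i ≤ q, BNSR.charVariety X x₀ K i 1 →
      BNSR.valuationComp v ρ ≠ 0 →
      BNSR.valuationComp v ρ ∉ BNSR.sigmaInvariant X x₀ q) ∧
    (∀ χ : Additive (BNSR.Pi1 X x₀) →+ ℝ,
      -χ ∈ BNSR.sigmaInvariant X x₀ q →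
      ∀ ρ : Multiplicative χ.range →* Kˣ, ¬ BNSR.IsAlgebraicInteger ρ →
        BNSR.pullbackChar χ ρ ∉ ⋃ i ≤ q, BNSR.charVariety X x₀ K i 1) := by
  refine ⟨fun ρ v hρ _ hv => ?_, fun χ hχ ρ hρ => ?_⟩
  · obtain ⟨θ, hθ, hl, hr⟩ := BNSR.exists_valuation_extension v ρ
    exact BNSR.notMem_iUnion_charVariety hv.2 θ hθ hl hr hρ
  · obtain ⟨θ, hθ, hl, hr⟩ := BNSR.exists_abelian_extension hρ
    have h := hχ.2
    rw [neg_neg] at h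
    exact BNSR.notMem_iUnion_charVariety h θ hθ hl hr
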